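/- Let $\Sigma$ be a finite alphabet, $\mathbb X$ a finite set of word variables disjoint from $\Sigma$, and $\Sigma_{\mathbb X}=\Sigma\cup\mathbb X$. Let $\Phi:\ \ell^1=r^1\wedge\dots\wedge \ell^n=r^n$ be a system of word equations ($\ell^j,r^j\in\Sigma_{\mathbb X}^*$) that is quadratic, i.e., every variable occurs at most twice in $\Phi$. A model of $\Phi$ is a map $I:\mathbb X\to\Sigma^*$ whose extension to terms (with $I(a)=a$ for $a\in\Sigma$) satisfies $I(\ell^j)=I(r^j)$ for all $j$. **Encoding.** Let $\#$ (padding) and $\dashv$ (delimiter) be new symbols, and $\Gamma=(\Sigma_{\mathbb X}\cup\{\#\})^2$. Write $[\beta;\gamma]$ for two-track letters and $\mathsf p=[\#;\#]$, $\mathsf d=[\dashv;\dashv]$. Let $\langle \ell,r\rangle\in\Gamma^*$ be the word with first track $\ell$ and second track $r$, the shorter one filled up by $\#$. Let $T_{trim}$ delete the longest prefix of letters of the form $[\beta;\beta]$ of a word of $\Gamma^*$. Put $\mathrm{enc}(\ell,r)=T_{trim}(\langle \ell,r\rangle\,\mathsf p^*)$ and $\mathrm{enc}(\Phi)=\mathrm{enc}(\ell^1,r^1)\,\mathsf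 d\cdots\mathsf d\,\mathrm{enc}(\ell^n,r^n)$. **Rules.** A rule $\rho$ is $y\hookrightarrow\alpha y$ or $y\hookrightarrow\varepsilon$ with $y\in\mathbb X$, $\alpha\in\Sigma_{\mathbb X}$. Its guard on a pair of tracks (or sides of an equation) is that their first symbols are $y$ and $\alpha$, in either order, for $y\hookrightarrow\alpha y$, and that at least one of the first symbols is $y$, for $y\hookrightarrow\varepsilon$. On a system, $\rho$ requires its guard for the first non-empty equation, replaces $y$ everywhere in the system by $\alpha y$ (resp. $\varepsilon$), and removes from every equation the longest common prefix of its sides. For a word $w\in\mathrm{enc}(\Psi)$, where no equation of $\Psi$ has a non-empty common prefix of its sides, $w[\rho]$ is the encoding of the system obtained from $\Psi$ by $\rho$. Let $S_\rho^{\le 2}$ be the length-preserving relation on $\Gamma^*$ that performs the substitution of $\rho$ on both tracks of words with at most two occurrences of $y$ on the two tracks together. On a track with $m$ occurrences of $y$, the substitution $y\mapsto\varepsilon$ deletes them and appends $\#^m$, and $y\mapsto\alpha y$ maps $u\#^m$ to $u[y/\alpha y]$. Let $T_\rho^{\le2}$ be $S_\rho^{\le 2}$ restricted to inputs that satisfy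 the guard of $\rho$, followed by $T_{trim}$, and let $$T^{seq,2}_\rho=\{\mathsf p\mapsto\mathsf p,\ \mathsf d\mapsto\mathsf d\}^*\,.\,T_\rho^{\le2}\,.\,\big(\{\mathsf d\mapsto\mathsf d\}.(T_{trim}\circ S_\rho^{\le2})\big)^*,$$ $$\mathcal I=\mathrm{enc}(\Phi),\quad \mathcal T_1=\bigcup_{y\in\mathbb X,\alpha\in\Sigma_{\mathbb X}}T^{seq,2}_{y\hookrightarrow\alpha y},\quad \mathcal T_2=\bigcup_{y\in\mathbb X}T^{seq,2}_{y\hookrightarrow\varepsilon},\quad \mathcal T=\mathcal T_1\cup\mathcal T_2,\quad \mathcal D=\{\mathsf p,\mathsf d\}^*.$$ For a language $L$ put $\mathrm{satur}^\bullet(L)=\{u_1u_2\cdots u_k \mid L\cap u_1\mathsf p^+u_2\mathsf p^+\cdots\mathsf p^+u_k\neq\emptyset\}$. **Algorithm.** Start with $reach_0=\mathcal I$, $processed=\emptyset$, $i=0$. While $reach_i\not\subseteq processed$: if $\mathcal D\cap reach_i\ne\emptyset$, extract and return an assignment as described below; otherwise add $reach_i$ to $processed$, put $reach_{i+1}=\mathrm{satur}^\bullet(\mathcal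 T(reach_i))$, and increase $i$. When the loop ends, return $\mathsf{false}$. Extraction: let $I(x)=\varepsilon$ for all $x\in\mathbb X$ and choose $w_i\in\mathcal D\cap reach_i$. For $\ell=i,\dots,1$ choose $w_{\ell-1}\in reach_{\ell-1}$ with $w_\ell\in\mathrm{satur}^\bullet(\mathcal T(\{w_{\ell-1}\}))$ and a rule $\rho$ with $w_\ell\in w_{\ell-1}[\rho]$, and, if $\rho$ is $y\hookrightarrow\alpha y$, set $I(y):=I(\alpha)I(y)$. Return $I$. **Claim.** The languages $\mathcal I$, $\mathcal D$ and all $reach_i$ are regular, the relations $\mathcal T_1$ and $\mathcal T_2$ are rational (accepted by finite two-tape transducers), and, for all choices made in the extraction, the algorithm is 1. sound: every assignment that it returns is a model of $\Phi$; 2. complete: if $\Phi$ is satisfiable, then it returns a model of $\Phi$ after finitely many steps; 3. terminating: it always returns an assignment or $\mathsf{false}$ after finitely many steps. -/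

import Mathlib

namespace WordEq

universe u v

/-! ### Word relations, transducers -/

section Relations

variable {α : Type*} {β : Type*} {γ : Type*}

/-- Concatenation of binary word relations. -/
def relConcat (R₁ R₂ : Set (List α × List β)) : Set (List α × List β) :=
  {p | ∃ q₁ ∈ R₁, ∃ q₂ ∈ R₂, p = (q₁.1 ++ q₂.1, q₁.2 ++ q₂.2)}

/-- Powers of a binary word relation with respect to concatenation. -/
def relPow (R : Set (List α × List β)) : ℕ → Set (List α × List β)
  | 0 => {([], [])}
  | n + 1 => relConcat R (relPow R n)

/-- Iteration `R^*` of a binary word relation. -/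
def relStar (R : Set (List α × List β)) : Set (List α × List β) :=
  ⋃ n : ℕ, relPow R n

/-- Composition `R₁ ∘ R₂`: first `R₂`, then `R₁`. -/
def relComp (R₁ : Set (List β × List γ)) (R₂ : Set (List α × List β)) :
    Set (List α × List γ) :=
  {p | ∃ y, (p.1, y) ∈ R₂ ∧ (y, p.2) ∈ R₁}

/-- The image `R(L)` of a language under a relation. -/
def relImage (R : Set (List α × List β)) (L : Language α) : Language β :=
  {y | ∃ x ∈ L, (x, y) ∈ R}

/-- A two-tape transducer with state set `Q`; in a transition label, `none` is the empty word. -/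
structure Transducer (α : Type*) (β : Type*) (Q : Type*) where
  trans : Q → Option α → Option β → Q → Prop
  initial : Set Q
  final : Set Q

/-- `T.Run q u v r`: there is a run of `T` from `q` to `r` over the pair of words `(u, v)`. -/
inductive Transducer.Run {Q : Type*} (T : Transducer α β Q) : Q → List α → List β → Q → Prop
  | nil (q : Q) : Transducer.Run T q [] [] q
  | cons {q r s : Q} {a : Option α} {b : Option β} {u : List α} {v : List β} :
      T.trans q a b r → Transducer.Run T r u v s →
        Transducer.Run T q (a.toList ++ u) (b.toList ++ v) s

/-- The relation accepted by a transducer. -/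
def Transducer.lang {Q : Type*} (T : Transducer α β Q) : Set (List α × List β) :=
  {p | ∃ q ∈ T.initial, ∃ r ∈ T.final, T.Run q p.1 p.2 r}

/-- Rational relations: those accepted by a finite two-tape transducer. -/
def IsRational (R : Set (List α × List β)) : Prop :=
  ∃ (Q : Type) (_ : Finite Q) (T : Transducer α β Q), T.lang = R

end Relations

/-! ### Word equations -/

/-- Word terms over the alphabet `A` and the word variables `V`. -/
abbrev Term (A : Type u) (V : Type v) := List (A ⊕ V)

/-- A word equation, as the pair of its two sides. -/
abbrev Equation (A : Type u) (V : Type v) := Term A V × Term A V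

/-- A system (conjunction) of word equations. -/
abbrev System (A : Type u) (V : Type v) := List (Equation A V)

/-- Assignments of words to variables. -/
abbrev Assignment (A : Type u) (V : Type v) := V → List A

section Equations

variable {A : Type u} {V : Type v}

/-- The lifting of an assignment to word terms. -/
def Assignment.eval (I : Assignment A V) (t : Term A V) : List A :=
  t.flatMap (Sum.elim (fun a => [a]) I)

/-- `I` is a model of the system `Φ`. -/
def IsModel (I : Assignment A V) (Φ : System A V) : Prop :=
  ∀ e ∈ Φ, I.eval e.1 = I.eval e.2

variable [DecidableEq A] [DecidableEq V]

/-- Every variable has at most two occurrences in the whole system. -/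
def IsQuadratic (Φ : System A V) : Prop :=
  ∀ x : V, (Φ.map fun e => (e.1 ++ e.2).count (Sum.inr x)).sum ≤ 2

/-- `substTerm x s t` replaces all occurrences of the variable `x` in `t` by `s`. -/
def substTerm (x : V) (s t : Term A V) : Term A V :=
  t.flatMap fun c => if c = Sum.inr x then s else [c]

/-- Removal of the longest common prefix of the two sides of an equation. -/
def trimEq : Term A V → Term A V → Equation A V
  | a :: s, b :: t => if a = b then trimEq s t else (a :: s, b :: t)
  | s, t => (s, t)

/-- Every equation of the system is trimmed. -/
def IsTrimmed (Φ : System A V) : Prop :=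
  ∀ e ∈ Φ, trimEq e.1 e.2 = e

end Equations

/-- The Nielsen rules: `prepend y α` is `y ↪ αy`, and `erase y` is `y ↪ ε`. -/
inductive Rule (A : Type u) (V : Type v)
  | prepend (y : V) (α : A ⊕ V)
  | erase (y : V)

namespace Rule

variable {A : Type u} {V : Type v}

/-- The variable that the rule replaces. -/
def var : Rule A V → V
  | prepend y _ => y
  | erase y => y

/-- The word term by which the rule replaces its variable. -/
def replacement : Rule A V → Term A V
  | prepend y α => [α, Sum.inr y]
  | erase _ => []

/-- The condition of the rule on the first symbols (if any) of the two sides of an equation. -/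
def Guard {S : Type*} (emb : A ⊕ V → S) (ρ : Rule A V) (l r : Option S) : Prop :=
  match ρ with
  | prepend y α =>
      (l = some (emb (Sum.inr y)) ∧ r = some (emb α)) ∨
        (l = some (emb α) ∧ r = some (emb (Sum.inr y)))
  | erase y => l = some (emb (Sum.inr y)) ∨ r = some (emb (Sum.inr y))

/-- The Nielsen step on a system: the rule is applied to the first non-empty equation, its
substitution is performed in the other equations regardless of their first symbols, and all
equations are trimmed. -/
def Applies [DecidableEq A] [DecidableEq V] (ρ : Rule A V) (Φ Φ' : System A V) : Prop :=
  ∃ (Φ₁ : System A V) (e : Equation A V) (Φ₂ : System A V),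
    Φ = Φ₁ ++ e :: Φ₂ ∧ (∀ d ∈ Φ₁, d = ([], [])) ∧
    ρ.Guard id e.1.head? e.2.head? ∧
    Φ' = Φ₁ ++ (e :: Φ₂).map fun d =>
      trimEq (substTerm ρ.var ρ.replacement d.1) (substTerm ρ.var ρ.replacement d.2)

/-- The update of the assignment when the rule is undone during the extraction of a model. -/
def undo [DecidableEq V] (ρ : Rule A V) (I : Assignment A V) : Assignment A V :=
  match ρ with
  | prepend y α => Function.update I y (I.eval [α] ++ I y)
  | erase _ => I

end Rule

/-! ### The two-track encoding -/

/-- Symbols and variables together with the padding symbol `# = none`. -/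
abbrev PadSym (A : Type u) (V : Type v) := Option (A ⊕ V)

/-- Letters of the two-track alphabet with padding. -/
abbrev Cell (A : Type u) (V : Type v) := PadSym A V × PadSym A V

/-- Letters of encoded systems: two-track letters, and the delimiter `[⊣;⊣]`. -/
inductive Letter (A : Type u) (V : Type v)
  | cell (c : Cell A V)
  | delim

/-- The letter `[#;#]`. -/
abbrev padLetter {A : Type u} {V : Type v} : Letter A V := Letter.cell (none, none)

section Encoding

variable {A : Type u} {V : Type v}

/-- Two word terms written on two tracks, the shorter one padded to the length of the longer. -/
def eqEncode : Term A V → Term A V → List (Cell A V)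
  | [], [] => []
  | a :: s, [] => (some a, none) :: eqEncode s []
  | [], b :: t => (none, some b) :: eqEncode [] t
  | a :: s, b :: t => (some a, some b) :: eqEncode s t

/-- A relation on words over the two-track alphabet, as a relation on words of letters. -/
def liftRel (R : Set (List (Cell A V) × List (Cell A V))) :
    Set (List (Letter A V) × List (Letter A V)) :=
  {p | ∃ q ∈ R, p = (q.1.map Letter.cell, q.2.map Letter.cell)}

/-- Padding of a two-track word by arbitrarily many `[#;#]`. -/
def padRel : Set (List (Cell A V) × List (Cell A V)) :=
  {p | ∃ k : ℕ, p.2 = p.1 ++ List.replicate k (none, none)}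

variable [DecidableEq A] [DecidableEq V]

/-- `T_trim`: removal of the longest prefix of letters of the form `[β;β]`. -/
def trimRel : Set (List (Cell A V) × List (Cell A V)) :=
  {p | p.2 = p.1.dropWhile fun c => decide (c.1 = c.2)}

/-- The set of encodings of an equation. -/
def encode (e : Equation A V) : Language (Cell A V) :=
  relImage (relComp trimRel padRel) {eqEncode e.1 e.2}

/-- The set of encodings of a system: encodings of its equations, separated by delimiters. -/
def encodeSystem (Φ : System A V) : Language (Letter A V) :=
  {w | ∃ ws : List (List (Cell A V)), List.Forall₂ (fun e x => x ∈ encode e) Φ ws ∧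
    w = [Letter.delim].intercalate (ws.map (List.map Letter.cell))}

/-- The substitution of a rule on one track with exactly `n` occurrences of its variable, as a
length-preserving relation. For `x ↦ ε`, the other symbols move to the left and the last `n`
positions of the output are filled with `#`. For `x ↦ αx`, the last `n` positions of the input
hold `#` and make room for the `n` inserted symbols `α`. -/
def trackSubst (ρ : Rule A V) (n : ℕ) : Set (List (PadSym A V) × List (PadSym A V)) :=
  match ρ with
  | Rule.erase x =>
      {p | p.1.count (some (Sum.inr x)) = n ∧
        p.2 = p.1.filter (fun c => decide (c ≠ some (Sum.inr x))) ++ List.replicate n none}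
  | Rule.prepend x α =>
      {p | p.1.count (some (Sum.inr x)) = n ∧
        ∃ w : List (PadSym A V), p.1 = w ++ List.replicate n none ∧
          p.2 = w.flatMap fun c =>
            if c = some (Sum.inr x) then [some α, some (Sum.inr x)] else [c]}

/-- `S^{≤ n}`: the substitution of a rule on two-track words with at most `n` occurrences of
its variable on the two tracks together. -/
def substRel (ρ : Rule A V) (n : ℕ) : Set (List (Cell A V) × List (Cell A V)) :=
  {p | ∃ m ≤ n, ∃ k ≤ m,
    (p.1.map Prod.fst, p.2.map Prod.fst) ∈ trackSubst ρ k ∧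
    (p.1.map Prod.snd, p.2.map Prod.snd) ∈ trackSubst ρ (m - k)}

/-- The relation `T^{≤ n}` of a Nielsen rule on encodings of single equations. -/
def ruleRel (ρ : Rule A V) (n : ℕ) : Set (List (Cell A V) × List (Cell A V)) :=
  relComp trimRel
    {p | ρ.Guard some (p.1.head?.map Prod.fst) (p.1.head?.map Prod.snd) ∧ p ∈ substRel ρ n}

/-- `T_pass`: copying of a word over `[#;#]` and `[⊣;⊣]`. -/
def passRel : Set (List (Letter A V) × List (Letter A V)) :=
  relStar {([padLetter], [padLetter]), ([Letter.delim], [Letter.delim])}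

/-- The relation `T^{seq,n}` of a Nielsen rule on encodings of systems. -/
def ruleSeqRel (ρ : Rule A V) (n : ℕ) : Set (List (Letter A V) × List (Letter A V)) :=
  relConcat passRel
    (relConcat (liftRel (ruleRel ρ n))
      (relStar
        (relConcat {([Letter.delim], [Letter.delim])}
          (liftRel (relComp trimRel (substRel ρ n))))))

/-- `w[ρ]`: the encodings of the system obtained by the rule `ρ` from the (trimmed) system that
`w` encodes. -/
def ruleImage (w : List (Letter A V)) (ρ : Rule A V) : Language (Letter A V) :=
  {w' | ∃ Φ Φ' : System A V, IsTrimmed Φ ∧ w ∈ encodeSystem Φ ∧ ρ.Applies Φ Φ' ∧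
    w' ∈ encodeSystem Φ'}

end Encoding

/-- `satur•`: a word `u₁ [#;#]⁺ u₂ [#;#]⁺ … u_k` of the language yields `u₁ u₂ … u_k`. In the
list `us`, the pair `(n, u)` stands for the factor `[#;#]^(n+1) u`. -/
def saturBullet {A : Type u} {V : Type v} (L : Language (Letter A V)) : Language (Letter A V) :=
  {z | ∃ w ∈ L, ∃ (u₁ : List (Letter A V)) (us : List (ℕ × List (Letter A V))),
    w = u₁ ++ us.flatMap (fun p => List.replicate (p.1 + 1) padLetter ++ p.2) ∧
    z = u₁ ++ us.flatMap (fun p => p.2)}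

/-! ### The algorithm -/

/-- Inputs of the algorithm: the initial set, the two transformers, the destination set. -/
structure RMCProblem (A : Type u) (V : Type v) where
  init : Language (Letter A V)
  transPrepend : Set (List (Letter A V) × List (Letter A V))
  transErase : Set (List (Letter A V) × List (Letter A V))
  dest : Language (Letter A V)

namespace RMCProblem

variable {A : Type u} {V : Type v}

/-- The languages of the problem are regular and its transformers are rational. -/
def IsEffective (P : RMCProblem A V) : Prop :=
  P.init.IsRegular ∧ IsRational P.transPrepend ∧ IsRational P.transErase ∧ P.dest.IsRegular

/-- One step of the exploration: `satur• ∘ T`, where `T` is the union of the transformers. -/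
def post (P : RMCProblem A V) (L : Language (Letter A V)) : Language (Letter A V) :=
  saturBullet (relImage (P.transPrepend ∪ P.transErase) L)

/-- The sets `reach_i`. -/
def reach (P : RMCProblem A V) : ℕ → Language (Letter A V)
  | 0 => P.init
  | i + 1 => P.post (P.reach i)

/-- Configurations of the algorithm: the head of the main loop with the loop counter `i` and the
set of processed words; the head of the loop of the model extraction with its counter `ℓ`, the
current word `w_ℓ` and the current assignment; and the end of the computation with the returned
value, where `none` stands for `false`. -/
inductive Config (A : Type u) (V : Type v)
  | main (i : ℕ) (processed : Language (Letter A V))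
  | extract (ℓ : ℕ) (w : List (Letter A V)) (I : Assignment A V)
  | ret (result : Option (Assignment A V))

variable [DecidableEq A] [DecidableEq V]

/-- The steps of the algorithm. All choices (of a word in the destination set, of a predecessor
and of a rule) are nondeterministic. -/
inductive Step (P : RMCProblem A V) : Config A V → Config A V → Prop
  | unsat {i : ℕ} {processed : Language (Letter A V)} :
      P.reach i ≤ processed →
      Step P (Config.main i processed) (Config.ret none)
  | found {i : ℕ} {processed : Language (Letter A V)} {w : List (Letter A V)} :
      ¬ P.reach i ≤ processed → w ∈ P.dest → w ∈ P.reach i →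
      Step P (Config.main i processed) (Config.extract i w fun _ => [])
  | iterate {i : ℕ} {processed : Language (Letter A V)} :
      ¬ P.reach i ≤ processed → (∀ w ∈ P.dest, w ∉ P.reach i) →
      Step P (Config.main i processed) (Config.main (i + 1) (processed + P.reach i))
  | back {ℓ : ℕ} {w w' : List (Letter A V)} {I : Assignment A V} {ρ : Rule A V} :
      w' ∈ P.reach ℓ → w ∈ P.post {w'} → w ∈ ruleImage w' ρ →
      Step P (Config.extract (ℓ + 1) w I) (Config.extract ℓ w' (ρ.undo I))
  | done {w : List (Letter A V)} {I : Assignment A V} :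
      Step P (Config.extract 0 w I) (Config.ret (some I))

/-- `c` is reached in some run of the algorithm. -/
def Reaches (P : RMCProblem A V) (c : Config A V) : Prop :=
  Relation.ReflTransGen P.Step (Config.main 0 0) c

/-- Whatever choices are made, the algorithm stops after finitely many steps, and it stops only by
returning a value that satisfies `Q`. -/
def AlwaysReturns (P : RMCProblem A V) (Q : Option (Assignment A V) → Prop) : Prop :=
  (¬ ∃ c : ℕ → Config A V, c 0 = Config.main 0 0 ∧ ∀ n, P.Step (c n) (c (n + 1))) ∧
  ∀ c, P.Reaches c → (¬ ∃ c', P.Step c c') → ∃ r, c = Config.ret r ∧ Q r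

/-- Every returned assignment is a model of `Φ`. -/
def IsSound (P : RMCProblem A V) (Φ : System A V) : Prop :=
  ∀ I, P.Reaches (Config.ret (some I)) → IsModel I Φ

/-- If `Φ` is satisfiable, then the algorithm returns a model of `Φ` in finitely many steps. -/
def IsComplete (P : RMCProblem A V) (Φ : System A V) : Prop :=
  (∃ I, IsModel I Φ) → P.AlwaysReturns fun r => ∃ I, r = some I ∧ IsModel I Φ

/-- The algorithm always returns an assignment or `false` in finitely many steps. -/
def IsTerminating (P : RMCProblem A V) : Prop :=
  P.AlwaysReturns fun _ => True

end RMCProblem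

/-- The instance of the algorithm for a quadratic system of word equations. The destination set
is `{[#;#], [⊣;⊣]}^*`. -/
def quadraticProblem {A : Type u} {V : Type v} [DecidableEq A] [DecidableEq V]
    (Φ : System A V) : RMCProblem A V where
  init := encodeSystem Φ
  transPrepend := ⋃ (y : V) (α : A ⊕ V), ruleSeqRel (Rule.prepend y α) 2
  transErase := ⋃ y : V, ruleSeqRel (Rule.erase y) 2
  dest := {w | ∀ c ∈ w, c = padLetter ∨ c = Letter.delim}

end WordEq

/-! The algorithm explores, through encodings, the systems that Nielsen steps reach from the trimmed
`Φ`. The set `nielsen Φ i` contains those reached by `i` steps, and `mem_reach` states that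
`reach_i` is exactly the set of their encodings. The correctness claims then become facts about
Nielsen's method.

Simulation. On encodings of a trimmed system, the relation of a rule produces only encodings of the
successor system (`exists_applies_of_mem_ruleSeqRel`). Conversely, every encoding of the successor
arises once the input carries enough padding and surplus `[#;#]` are deleted afterwards
(`exists_mem_ruleSeqRel_of_applies`). This deletion is what the saturation does, and it never leaves
the set of encodings of a system (`mem_encodeSystem_of_padDelRel`).

Termination. In a quadratic system, `y ↪ αy` inserts at most two copies of `α`. In the equation that
satisfies the guard, both sides then start with `α`, so trimming removes two copies. Hence no
weighted symbol count grows (`Rule.Applies.weight_le`): systems stay quadratic and of bounded size,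
and only finitely many occur. Some `reach_N` is therefore covered by earlier ones
(`exists_reach_le_processed`).

Soundness. A model of the successor pulls back to its predecessor by undoing the rule. For `y ↪ ε`
this requires `I y = ε`, so the extraction invariant also says that variables not occurring in the
current system are sent to `ε` (`Rule.Applies.undo`).

Completeness. A model of an unsolved system selects an applicable rule that yields a successor with
a model. The pair (total length of the values, size of the system) decreases lexicographically, so a
solved system is reached (`exists_solved_mem_nielsen`). If the loop stopped with `false`, every
reachable word would already have been processed and tested against `𝒟`.

Effectiveness. Rational relations are closed under union, concatenation, star and composition, and
they map regular languages to regular ones. The substitution on a track is length-preserving, and as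
a language of pairs it is recognized with a bounded buffer (`isRegular_delayLang`). -/

namespace WordEq

open Set

/-! ### Closure properties of rational relations -/

section Rational

variable {α : Type*} {β : Type*} {γ : Type*}

namespace Transducer

variable {Q : Type*} (T : Transducer α β Q)

/-- The transducer accepts the pair `(u, v)` when started in the state `q`. -/
def Acc (q : Q) (u : List α) (v : List β) : Prop :=
  ∃ r ∈ T.final, T.Run q u v r

variable {T}

theorem Acc.nil {q : Q} (h : q ∈ T.final) : T.Acc q [] [] :=
  ⟨q, h, .nil q⟩

theorem Acc.step {q r : Q} {a : Option α} {b : Option β} {u : List α} {v : List β}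
    (h : T.trans q a b r) (h' : T.Acc r u v) : T.Acc q (a.toList ++ u) (b.toList ++ v) :=
  let ⟨s, hs, hr⟩ := h'
  ⟨s, hs, .cons h hr⟩

theorem Acc.eps {q r : Q} {u : List α} {v : List β}
    (h : T.trans q none none r) (h' : T.Acc r u v) : T.Acc q u v :=
  Acc.step h h'

theorem Acc.induct {M : Q → List α → List β → Prop}
    (nil : ∀ q ∈ T.final, M q [] [])
    (step : ∀ q a b r u v, T.trans q a b r → T.Acc r u v → M r u v →
      M q (a.toList ++ u) (b.toList ++ v))
    {q : Q} {u : List α} {v : List β} (h : T.Acc q u v) : M q u v := by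
  obtain ⟨s, hs, hr⟩ := h
  induction hr with
  | nil q => exact nil q hs
  | cons ht hr ih => exact step _ _ _ _ _ _ ht ⟨_, hs, hr⟩ (ih hs)

theorem mem_lang {p : List α × List β} : p ∈ T.lang ↔ ∃ q ∈ T.initial, T.Acc q p.1 p.2 :=
  Iff.rfl

end Transducer

open Transducer

/-- `IsRational` asks for a state set in `Type`; a finite state set in any universe is renumbered by
some `Fin n`. -/
theorem isRational_of_finite {Q : Type*} [Finite Q] (T : Transducer α β Q)
    {R : Set (List α × List β)}
    (h : ∀ u v, (u, v) ∈ R ↔ ∃ q ∈ T.initial, T.Acc q u v) : IsRational R := by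
  obtain ⟨n, ⟨e⟩⟩ := Finite.exists_equiv_fin Q
  let T' : Transducer α β (Fin n) :=
    ⟨fun q a b r => T.trans (e.symm q) a b (e.symm r), e.symm ⁻¹' T.initial, e.symm ⁻¹' T.final⟩
  refine ⟨Fin n, inferInstance, T', ?_⟩
  ext ⟨u, v⟩
  rw [mem_lang, h]
  constructor
  · rintro ⟨q, hq, hacc⟩
    refine ⟨e.symm q, hq, ?_⟩
    refine Acc.induct (T := T') (M := fun q u v => T.Acc (e.symm q) u v)
      (fun q hq => .nil hq) (fun q a b r u v ht _ ih => .step ht ih) hacc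
  · rintro ⟨q, hq, hacc⟩
    refine ⟨e q, by simpa [T'] using hq, ?_⟩
    refine Acc.induct (T := T) (M := fun q u v => T'.Acc (e q) u v)
      (fun q hq => .nil (by simpa [T'] using hq))
      (fun q a b r u v ht _ ih => .step (by simpa [T'] using ht) ih) hacc

theorem IsRational.iUnion {ι : Type*} [Finite ι] {R : ι → Set (List α × List β)}
    (h : ∀ i, IsRational (R i)) : IsRational (⋃ i, R i) := by
  choose Q hQ T hT using h
  let T' : Transducer α β (Σ i, Q i) :=
    ⟨fun x a b y => ∃ i q r, x = ⟨i, q⟩ ∧ y = ⟨i, r⟩ ∧ (T i).trans q a b r,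
      {x | x.2 ∈ (T x.1).initial}, {x | x.2 ∈ (T x.1).final}⟩
  refine isRational_of_finite T' fun u v => ?_
  simp only [mem_iUnion, ← hT, mem_lang]
  constructor
  · rintro ⟨i, q, hq, hacc⟩
    refine ⟨⟨i, q⟩, hq, ?_⟩
    exact Acc.induct (M := fun q u v => T'.Acc ⟨i, q⟩ u v)
      (fun q hq => .nil hq) (fun q a b r u v ht _ ih => .step ⟨i, q, r, rfl, rfl, ht⟩ ih) hacc
  · rintro ⟨⟨i, q⟩, hq, hacc⟩
    refine ⟨i, q, hq, ?_⟩
    refine Acc.induct (T := T') (M := fun x u v => (T x.1).Acc x.2 u v)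
      (fun q hq => .nil hq) ?_ hacc
    rintro _ a b _ u v ⟨i, q, r, rfl, rfl, ht⟩ _ ih
    exact .step ht ih

theorem IsRational.union {R₁ R₂ : Set (List α × List β)} (h₁ : IsRational R₁)
    (h₂ : IsRational R₂) : IsRational (R₁ ∪ R₂) := by
  rw [union_eq_iUnion]
  exact .iUnion (by rintro (_ | _) <;> simpa)

theorem mem_relConcat {R₁ R₂ : Set (List α × List β)} {u v} :
    (u, v) ∈ relConcat R₁ R₂ ↔ ∃ u₁ v₁ u₂ v₂, (u₁, v₁) ∈ R₁ ∧ (u₂, v₂) ∈ R₂ ∧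
      u = u₁ ++ u₂ ∧ v = v₁ ++ v₂ := by
  simp only [relConcat, mem_ofPred_eq, Prod.exists, Prod.mk.injEq]
  constructor
  · rintro ⟨u₁, v₁, h₁, u₂, v₂, h₂, rfl, rfl⟩
    exact ⟨_, _, _, _, h₁, h₂, rfl, rfl⟩
  · rintro ⟨u₁, v₁, u₂, v₂, h₁, h₂, rfl, rfl⟩
    exact ⟨_, _, h₁, _, _, h₂, rfl, rfl⟩

theorem append_mem_relConcat {R₁ R₂ : Set (List α × List β)} {u₁ v₁ u₂ v₂}
    (h₁ : (u₁, v₁) ∈ R₁) (h₂ : (u₂, v₂) ∈ R₂) : (u₁ ++ u₂, v₁ ++ v₂) ∈ relConcat R₁ R₂ :=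
  mem_relConcat.2 ⟨_, _, _, _, h₁, h₂, rfl, rfl⟩

theorem IsRational.concat {R₁ R₂ : Set (List α × List β)} (h₁ : IsRational R₁)
    (h₂ : IsRational R₂) : IsRational (relConcat R₁ R₂) := by
  obtain ⟨Q₁, _, T₁, rfl⟩ := h₁
  obtain ⟨Q₂, _, T₂, rfl⟩ := h₂
  let T : Transducer α β (Q₁ ⊕ Q₂) :=
    { trans := fun x a b y => match x, y with
        | .inl q, .inl r => T₁.trans q a b r
        | .inl q, .inr r => a = none ∧ b = none ∧ q ∈ T₁.final ∧ r ∈ T₂.initial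
        | .inr q, .inr r => T₂.trans q a b r
        | .inr _, .inl _ => False
      initial := Sum.inl '' T₁.initial
      final := Sum.inr '' T₂.final }
  refine isRational_of_finite T fun u v => ?_
  rw [mem_relConcat]
  constructor
  · rintro ⟨u₁, v₁, u₂, v₂, ⟨q₁, hq₁, hacc₁⟩, ⟨q₂, hq₂, hacc₂⟩, rfl, rfl⟩
    refine ⟨.inl q₁, ⟨q₁, hq₁, rfl⟩, ?_⟩
    have h₂ : T.Acc (.inr q₂) u₂ v₂ := Acc.induct (M := fun q u v => T.Acc (.inr q) u v)
      (fun q hq => .nil ⟨q, hq, rfl⟩)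
      (fun q a b r u v ht _ ih => .step (r := Sum.inr r) ht ih) hacc₂
    refine Acc.induct (M := fun q u v => T.Acc (.inl q) (u ++ u₂) (v ++ v₂)) ?_ ?_ hacc₁
    · intro q hq
      exact .eps (r := Sum.inr q₂) ⟨rfl, rfl, hq, hq₂⟩ h₂
    · intro q a b r u v ht _ ih
      simpa only [List.append_assoc] using Acc.step (q := Sum.inl q) (r := Sum.inl r) ht ih
  · rintro ⟨_, ⟨q, hq, rfl⟩, hacc⟩
    -- The motive depends on the copy: in the second one, acceptance by `T₂`; in the first one, a
    -- factorization whose second factor is still to be read by `T₂`.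
    have key : Sum.elim
        (fun q => ∃ u₁ v₁ u₂ v₂, T₁.Acc q u₁ v₁ ∧ (u₂, v₂) ∈ T₂.lang ∧
          u = u₁ ++ u₂ ∧ v = v₁ ++ v₂)
        (fun q => T₂.Acc q u v) (Sum.inl q : Q₁ ⊕ Q₂) := by
      refine Acc.induct (T := T) (M := fun x u v => Sum.elim
        (fun q => ∃ u₁ v₁ u₂ v₂, T₁.Acc q u₁ v₁ ∧ (u₂, v₂) ∈ T₂.lang ∧
          u = u₁ ++ u₂ ∧ v = v₁ ++ v₂)
        (fun q => T₂.Acc q u v) x) ?_ ?_ hacc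
      · rintro _ ⟨q, hq, rfl⟩
        exact .nil hq
      · rintro (q | q) a b (r | r) u v ht - ih
        · obtain ⟨u₁, v₁, u₂, v₂, h₁, h₂, rfl, rfl⟩ := ih
          exact ⟨_, _, u₂, v₂, .step ht h₁, h₂, by simp, by simp⟩
        · obtain ⟨rfl, rfl, hq, hr⟩ := ht
          exact ⟨[], [], u, v, .nil hq, ⟨r, hr, ih⟩, rfl, rfl⟩
        · exact ht.elim
        · exact Acc.step ht ih
    obtain ⟨u₁, v₁, u₂, v₂, h₁, h₂, rfl, rfl⟩ := key
    exact ⟨u₁, v₁, u₂, v₂, ⟨q, hq, h₁⟩, h₂, rfl, rfl⟩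

theorem nil_mem_relStar (R : Set (List α × List β)) : ([], []) ∈ relStar R :=
  mem_iUnion.2 ⟨0, rfl⟩

theorem append_mem_relStar {R : Set (List α × List β)} {u₁ v₁ u₂ v₂}
    (h₁ : (u₁, v₁) ∈ R) (h₂ : (u₂, v₂) ∈ relStar R) : (u₁ ++ u₂, v₁ ++ v₂) ∈ relStar R := by
  obtain ⟨n, hn⟩ := mem_iUnion.1 h₂
  exact mem_iUnion.2 ⟨n + 1, append_mem_relConcat h₁ hn⟩

theorem relStar_induction {R : Set (List α × List β)} {M : List α → List β → Prop}
    (nil : M [] [])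
    (append : ∀ u₁ v₁ u₂ v₂, (u₁, v₁) ∈ R → M u₂ v₂ → M (u₁ ++ u₂) (v₁ ++ v₂))
    {u v} (h : (u, v) ∈ relStar R) : M u v := by
  obtain ⟨n, hn⟩ := mem_iUnion.1 h
  induction n generalizing u v with
  | zero => cases hn; exact nil
  | succ n ih =>
    obtain ⟨u₁, v₁, u₂, v₂, h₁, h₂, rfl, rfl⟩ := mem_relConcat.1 hn
    exact append _ _ _ _ h₁ (ih (mem_iUnion.2 ⟨n, h₂⟩) h₂)

/-- The extra state `none` is the only initial and the only final state; empty transitions enter `T`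
from it and return to it between two factors. -/
theorem IsRational.star {R : Set (List α × List β)} (h : IsRational R) :
    IsRational (relStar R) := by
  obtain ⟨Q, _, T, rfl⟩ := h
  let T' : Transducer α β (Option Q) :=
    { trans := fun x a b y => match x, y with
        | some q, some r => T.trans q a b r
        | some q, none => a = none ∧ b = none ∧ q ∈ T.final
        | none, some r => a = none ∧ b = none ∧ r ∈ T.initial
        | none, none => False
      initial := {none}
      final := {none} }
  refine isRational_of_finite T' fun u v => ?_
  constructor
  · refine fun h => ⟨none, rfl, ?_⟩
    refine relStar_induction (M := fun u v => T'.Acc none u v) (.nil rfl) ?_ h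
    rintro u₁ v₁ u₂ v₂ ⟨q, hq, hacc⟩ h₂
    refine .eps (r := some q) ⟨rfl, rfl, hq⟩ ?_
    refine Acc.induct (M := fun q u v => T'.Acc (some q) (u ++ u₂) (v ++ v₂)) ?_ ?_ hacc
    · intro q hq
      exact .eps (r := none) ⟨rfl, rfl, hq⟩ h₂
    · intro q a b r u v ht _ ih
      simpa only [List.append_assoc] using Acc.step (q := some q) (r := some r) ht ih
  · rintro ⟨_, rfl, hacc⟩
    refine Acc.induct (T := T') (M := fun x u v => x.elim ((u, v) ∈ relStar T.lang)
      fun q => ∃ u₁ v₁ u₂ v₂, T.Acc q u₁ v₁ ∧ (u₂, v₂) ∈ relStar T.lang ∧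
          u = u₁ ++ u₂ ∧ v = v₁ ++ v₂) ?_ ?_ hacc
    · rintro _ rfl
      exact nil_mem_relStar _
    · rintro (_ | q) a b (_ | r) u v ht - ih
      · exact ht.elim
      · obtain ⟨rfl, rfl, hr⟩ := ht
        obtain ⟨u₁, v₁, u₂, v₂, h₁, h₂, rfl, rfl⟩ := ih
        exact append_mem_relStar (u₁ := u₁) (v₁ := v₁) ⟨r, hr, h₁⟩ h₂
      · obtain ⟨rfl, rfl, hr⟩ := ht
        exact ⟨[], [], u, v, .nil hr, ih, rfl, rfl⟩
      · obtain ⟨u₁, v₁, u₂, v₂, h₁, h₂, rfl, rfl⟩ := ih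
        exact ⟨_, _, u₂, v₂, .step ht h₁, h₂, by simp, by simp⟩

/-- The product machine guesses the middle word: both components move on a common middle letter, or
one moves alone without using the middle tape. -/
theorem IsRational.comp {R₁ : Set (List β × List γ)} {R₂ : Set (List α × List β)}
    (h₁ : IsRational R₁) (h₂ : IsRational R₂) : IsRational (relComp R₁ R₂) := by
  obtain ⟨Q₂, _, T₂, rfl⟩ := h₁
  obtain ⟨Q₁, _, T₁, rfl⟩ := h₂
  let T : Transducer α γ (Q₁ × Q₂) :=
    { trans := fun x a c y =>
        (∃ b, T₁.trans x.1 a (some b) y.1 ∧ T₂.trans x.2 (some b) c y.2) ∨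
        (T₁.trans x.1 a none y.1 ∧ c = none ∧ x.2 = y.2) ∨
        (T₂.trans x.2 none c y.2 ∧ a = none ∧ x.1 = y.1)
      initial := T₁.initial ×ˢ T₂.initial
      final := T₁.final ×ˢ T₂.final }
  refine isRational_of_finite T fun u w => ?_
  constructor
  · rintro ⟨v, ⟨q₁, hq₁, h₁⟩, ⟨q₂, hq₂, h₂⟩⟩
    refine ⟨(q₁, q₂), ⟨hq₁, hq₂⟩, ?_⟩
    -- Outer induction on the run that writes the middle word. Inner inductions let the other
    -- machine make its input-free moves until it reads the next middle letter or stops.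
    refine Acc.induct (M := fun q₁ u v => ∀ q₂ w, T₂.Acc q₂ v w → T.Acc (q₁, q₂) u w)
      ?_ ?_ h₁ q₂ w h₂
    · intro q₁ hq₁ q₂ w h₂
      refine Acc.induct (M := fun q₂ v w => v = [] → T.Acc (q₁, q₂) [] w) ?_ ?_ h₂ rfl
      · exact fun q₂ hq₂ _ => .nil ⟨hq₁, hq₂⟩
      · rintro q₂ (_ | b) c r v w ht - ih hv
        · exact .step (a := none) (r := (q₁, r)) (.inr (.inr ⟨ht, rfl, rfl⟩)) (ih hv)
        · simp at hv
    · rintro q₁ a (_ | b) r₁ u v ht₁ - ih q₂ w h₂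
      · exact .step (b := none) (r := (r₁, q₂)) (.inr (.inl ⟨ht₁, rfl, rfl⟩)) (ih q₂ w h₂)
      · refine Acc.induct
          (M := fun q₂ v' w => v' = b :: v → T.Acc (q₁, q₂) (a.toList ++ u) w) ?_ ?_ h₂ rfl
        · simp
        · rintro q₂ (_ | b') c r v' w ht h' ih' hv
          · exact .step (a := none) (r := (q₁, r)) (.inr (.inr ⟨ht, rfl, rfl⟩)) (ih' hv)
          · obtain ⟨rfl, rfl⟩ : b' = b ∧ v' = v := by simpa using hv
            exact .step (r := (r₁, r)) (.inl ⟨b', ht₁, ht⟩) (ih _ _ h')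
  · rintro ⟨⟨q₁, q₂⟩, ⟨hq₁, hq₂⟩, hacc⟩
    obtain ⟨v, h₁, h₂⟩ := Acc.induct (T := T)
      (M := fun x u w => ∃ v, T₁.Acc x.1 u v ∧ T₂.Acc x.2 v w) (by
        rintro x ⟨h₁, h₂⟩
        exact ⟨[], .nil h₁, .nil h₂⟩) (by
        rintro ⟨q₁, q₂⟩ a c ⟨r₁, r₂⟩ u w ht - ⟨v, h₁, h₂⟩
        rcases ht with ⟨b, ht₁, ht₂⟩ | ⟨ht, rfl, rfl⟩ | ⟨ht, rfl, rfl⟩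
        · exact ⟨b :: v, .step ht₁ h₁, .step ht₂ h₂⟩
        · exact ⟨v, .step ht h₁, h₂⟩
        · exact ⟨v, h₁, .step ht h₂⟩) hacc
    exact ⟨v, ⟨q₁, hq₁, h₁⟩, q₂, hq₂, h₂⟩

theorem IsRational.map {α' β' : Type*} {R : Set (List α × List β)} (h : IsRational R)
    (f : α → α') (g : β → β') :
    IsRational {p : List α' × List β' | ∃ q ∈ R, p = (q.1.map f, q.2.map g)} := by
  obtain ⟨Q, _, T, rfl⟩ := h
  let T' : Transducer α' β' Q :=
    ⟨fun q a b r => ∃ a' b', a = a'.map f ∧ b = b'.map g ∧ T.trans q a' b' r, T.initial, T.final⟩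
  refine isRational_of_finite T' fun u v => ?_
  constructor
  · rintro ⟨⟨u', v'⟩, ⟨q, hq, hacc⟩, h⟩
    obtain ⟨rfl, rfl⟩ := Prod.mk.inj h
    refine ⟨q, hq, Acc.induct (M := fun q u v => T'.Acc q (u.map f) (v.map g))
      (fun q hq => .nil hq) ?_ hacc⟩
    rintro q a b r u v ht - ih
    have := Acc.step (T := T') (a := a.map f) (b := b.map g) ⟨a, b, rfl, rfl, ht⟩ ih
    cases a <;> cases b <;> simpa using this
  · rintro ⟨q, hq, hacc⟩
    obtain ⟨u', v', h, rfl, rfl⟩ := Acc.induct (T := T')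
      (M := fun q u v => ∃ u' v', T.Acc q u' v' ∧ u = u'.map f ∧ v = v'.map g)
      (fun q hq => ⟨[], [], .nil hq, rfl, rfl⟩) (by
        rintro q _ _ r _ _ ⟨a, b, rfl, rfl, ht⟩ - ⟨u, v, h, rfl, rfl⟩
        exact ⟨_, _, .step ht h, by cases a <;> simp, by cases b <;> simp⟩) hacc
    exact ⟨(u', v'), ⟨q, hq, h⟩, rfl⟩

theorem isRational_singleton_toList (a : Option α) (b : Option β) :
    IsRational {(a.toList, b.toList)} := by
  let T : Transducer α β Bool :=
    ⟨fun q a' b' r => q = false ∧ r = true ∧ a' = a ∧ b' = b, {false}, {true}⟩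
  refine isRational_of_finite T fun u v => ?_
  constructor
  · rintro h
    obtain ⟨rfl, rfl⟩ := Prod.mk.inj h
    refine ⟨false, rfl, ?_⟩
    simpa using Acc.step (T := T) (u := []) (v := []) (r := true) (a := a) (b := b)
      ⟨rfl, rfl, rfl, rfl⟩ (.nil rfl)
  · rintro ⟨_, rfl, hacc⟩
    have := Acc.induct (T := T) (M := fun q u v =>
      bif q then u = [] ∧ v = [] else u = a.toList ∧ v = b.toList) (by
        rintro _ rfl
        exact ⟨rfl, rfl⟩) (by
        rintro _ _ _ _ _ _ ⟨rfl, rfl, rfl, rfl⟩ - h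
        simpa using h) hacc
    simpa using this

/-- Length-preserving relations given by a regular language of words of pairs. -/
theorem isRational_sync {L : Language (α × β)} (h : L.IsRegular) :
    IsRational {p : List α × List β | ∃ z ∈ L, p = (z.map Prod.fst, z.map Prod.snd)} := by
  obtain ⟨σ, _, M, rfl⟩ := h
  let T : Transducer α β σ :=
    ⟨fun q a b r => ∃ c : α × β, a = some c.1 ∧ b = some c.2 ∧ r = M.step q c,
      {M.start}, M.accept⟩
  refine isRational_of_finite T fun u v => ?_
  constructor
  · rintro ⟨z, hz, h⟩
    obtain ⟨rfl, rfl⟩ := Prod.mk.inj h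
    refine ⟨M.start, rfl, ?_⟩
    have : ∀ (z : List (α × β)) (q : σ), M.evalFrom q z ∈ M.accept →
        T.Acc q (z.map Prod.fst) (z.map Prod.snd) := by
      intro z
      induction z with
      | nil => exact fun q hq => .nil hq
      | cons c z ih =>
        intro q hq
        exact .step (a := some c.1) (b := some c.2) ⟨c, rfl, rfl, rfl⟩ (ih _ hq)
    exact this z _ hz
  · rintro ⟨_, rfl, hacc⟩
    obtain ⟨z, hz, rfl, rfl⟩ := Acc.induct (T := T)
      (M := fun q u v => ∃ z, M.evalFrom q z ∈ M.accept ∧ u = z.map Prod.fst ∧ v = z.map Prod.snd)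
      (fun q hq => ⟨[], hq, rfl, rfl⟩) (by
        rintro q _ _ _ _ _ ⟨c, rfl, rfl, rfl⟩ - ⟨z, hz, rfl, rfl⟩
        exact ⟨c :: z, hz, rfl, rfl⟩) hacc
    exact ⟨z, hz, rfl⟩

theorem isRational_nil_prod {L : Language β} (h : L.IsRegular) :
    IsRational {p : List α × List β | p.1 = [] ∧ p.2 ∈ L} := by
  obtain ⟨σ, _, M, rfl⟩ := h
  let T : Transducer α β σ :=
    ⟨fun q a b r => ∃ c, a = none ∧ b = some c ∧ r = M.step q c, {M.start}, M.accept⟩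
  refine isRational_of_finite T fun u v => ?_
  constructor
  · rintro ⟨hu, hv⟩
    obtain rfl : u = [] := hu
    refine ⟨M.start, rfl, ?_⟩
    have : ∀ (z : List β) (q : σ), M.evalFrom q z ∈ M.accept → T.Acc q [] z := by
      intro z
      induction z with
      | nil => exact fun q hq => .nil hq
      | cons c z ih =>
        intro q hq
        exact .step (a := none) (b := some c) ⟨c, rfl, rfl, rfl⟩ (ih _ hq)
    exact this v _ hv
  · rintro ⟨_, rfl, hacc⟩
    exact Acc.induct (T := T)
      (M := fun q u v => u = [] ∧ M.evalFrom q v ∈ M.accept)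
      (fun q hq => ⟨rfl, hq⟩) (by
        rintro q _ _ _ _ v ⟨c, rfl, rfl, rfl⟩ - ⟨rfl, hz⟩
        exact ⟨rfl, hz⟩) hacc

/-! ### Regular languages by way of rational relations -/

theorem isRegular_of_mem_iff {L L' : Language α} (h : L'.IsRegular)
    (hL : ∀ v, v ∈ L ↔ v ∈ L') : L.IsRegular := by
  rwa [show L = L' from Set.ext hL]

theorem isRegular_of_finite_NFA {σ : Type*} [Finite σ] (M : NFA α σ) : M.accepts.IsRegular := by
  have := Fintype.ofFinite (Set σ)
  exact Language.isRegular_iff.2 ⟨Set σ, inferInstance, M.toDFA, M.toDFA_correct⟩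

/-- Forgetting the input labels of a transducer leaves an automaton with empty moves for the output
words. -/
theorem IsRational.range {R : Set (List α × List β)} (h : IsRational R) :
    Language.IsRegular ({v | ∃ u, (u, v) ∈ R} : Language β) := by
  obtain ⟨Q, _, T, rfl⟩ := h
  let N : εNFA β Q := ⟨fun q b => {r | ∃ a, T.trans q a b r}, T.initial, T.final⟩
  have : N.accepts = ({v | ∃ u, (u, v) ∈ T.lang} : Language β) := by
    ext v
    rw [εNFA.mem_accepts_iff_exists_path]
    constructor
    · rintro ⟨q, r, x, hq, hr, rfl, hp⟩
      suffices ∃ u, T.Acc q u x.reduceOption from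
        let ⟨u, hu⟩ := this
        ⟨u, q, hq, hu⟩
      clear hq
      induction hp with
      | nil => exact ⟨[], .nil hr⟩
      | cons t s r a x h hp ih =>
        obtain ⟨u, hu⟩ := ih hr
        obtain ⟨a', ha⟩ := h
        have := Acc.step ha hu
        exact ⟨a'.toList ++ u, by cases a <;> simpa using this⟩
    · rintro ⟨u, q, hq, hacc⟩
      have : ∃ r ∈ T.final, ∃ x, x.reduceOption = v ∧ N.IsPath q r x := by
        refine Acc.induct
          (M := fun q u v => ∃ r ∈ T.final, ∃ x, x.reduceOption = v ∧ N.IsPath q r x) ?_ ?_ hacc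
        · exact fun q hq => ⟨q, hq, [], rfl, .nil q⟩
        · rintro q a b r u v ht - ⟨s, hs, x, rfl, hx⟩
          exact ⟨s, hs, b :: x, by cases b <;> simp, .cons _ _ _ _ _ ⟨a, ht⟩ hx⟩
      obtain ⟨r, hr, x, hx, hp⟩ := this
      exact ⟨q, r, x, hq, hr, hx, hp⟩
  rw [← this, ← N.toNFA_correct]
  exact isRegular_of_finite_NFA _

/-- With this, closure properties of regular languages follow from those of rational relations. -/
theorem isRegular_iff_isRational {L : Language β} :
    L.IsRegular ↔ IsRational {p : List Unit × List β | p.1 = [] ∧ p.2 ∈ L} := by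
  refine ⟨isRational_nil_prod, fun h => ?_⟩
  refine isRegular_of_mem_iff h.range fun v => ?_
  exact ⟨fun h => ⟨[], rfl, h⟩, fun ⟨u, h⟩ => h.2⟩

theorem IsRational.relImage {R : Set (List α × List β)} (h : IsRational R) {L : Language α}
    (hL : L.IsRegular) : (relImage R L).IsRegular := by
  refine isRegular_of_mem_iff (h.comp (isRational_nil_prod (α := Unit) hL)).range fun v => ?_
  constructor
  · rintro ⟨u, hu, huv⟩
    exact ⟨[], u, ⟨rfl, hu⟩, huv⟩
  · rintro ⟨_, u, ⟨-, hu⟩, huv⟩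
    exact ⟨u, hu, huv⟩

theorem isRegular_mul {L₁ L₂ : Language β} (h₁ : L₁.IsRegular) (h₂ : L₂.IsRegular) :
    (L₁ * L₂).IsRegular := by
  rw [isRegular_iff_isRational] at *
  convert h₁.concat h₂ using 1
  ext ⟨u, v⟩
  simp only [mem_relConcat, mem_ofPred_eq, Language.mem_mul]
  constructor
  · rintro ⟨rfl, v₁, h₁, v₂, h₂, rfl⟩
    exact ⟨[], v₁, [], v₂, ⟨rfl, h₁⟩, ⟨rfl, h₂⟩, rfl, rfl⟩
  · rintro ⟨_, v₁, _, v₂, ⟨rfl, h₁⟩, ⟨rfl, h₂⟩, rfl, rfl⟩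
    exact ⟨rfl, v₁, h₁, v₂, h₂, rfl⟩

theorem isRegular_map {L : Language α} (h : L.IsRegular) (f : α → β) :
    (Language.map f L).IsRegular := by
  rw [isRegular_iff_isRational] at *
  convert h.map id f using 1
  ext ⟨u, v⟩
  simp only [mem_ofPred_eq, Prod.exists, Prod.mk.injEq, List.map_id, Language.map]
  constructor
  · rintro ⟨rfl, w, hw, rfl⟩
    exact ⟨[], w, ⟨rfl, hw⟩, rfl, rfl⟩
  · rintro ⟨_, w, ⟨rfl, hw⟩, rfl, rfl⟩
    exact ⟨rfl, w, hw, rfl⟩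

theorem isRegular_comap {L : Language β} (h : L.IsRegular) (f : α → β) :
    Language.IsRegular ({z | z.map f ∈ L} : Language α) := by
  obtain ⟨σ, _, M, rfl⟩ := h
  exact ⟨σ, inferInstance, M.comap f, by rw [DFA.accepts_comap]; rfl⟩

theorem isRegular_singleton (u : List α) : Language.IsRegular ({u} : Language α) := by
  induction u with
  | nil =>
    refine isRegular_of_mem_iff (isRational_singleton_toList (none : Option Unit) none).range ?_
    exact fun v => ⟨fun h => ⟨[], by rw [show v = [] from h]; rfl⟩,
      fun ⟨_, h⟩ => (Prod.mk.inj h).2⟩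
  | cons a u ih =>
    have h := (isRational_singleton_toList (none : Option Unit) (some a)).range
    refine isRegular_of_mem_iff (isRegular_mul h ih) fun v => .trans ?_ Language.mem_mul.symm
    constructor
    · rintro h
      exact ⟨[a], ⟨[], rfl⟩, u, rfl, h.symm⟩
    · rintro ⟨_, ⟨_, h⟩, _, h', rfl⟩
      rw [show _ = _ from h', (Prod.mk.inj h).2]
      rfl

end Rational

/-! ### Regular languages of synchronized track pairs -/

section Sync

variable {α β : Type*}

/-- Myhill–Nerode: closure under one-letter quotients puts all left quotients of `L` into the finite
family `S`. -/
theorem isRegular_of_leftQuotient_mem {L : Language α} {S : Set (Language α)} (hS : S.Finite)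
    (hL : L ∈ S) (h : ∀ K ∈ S, ∀ a, K.leftQuotient [a] ∈ S) : L.IsRegular := by
  refine .of_finite_range_leftQuotient (hS.subset ?_)
  rintro _ ⟨x, rfl⟩
  induction x generalizing L with
  | nil => exact hL
  | cons a x ih =>
    have := ih (h L hL a)
    rwa [← Language.leftQuotient_append] at this

theorem isRegular_forall_mem (P : α → Prop) :
    Language.IsRegular ({z | ∀ c ∈ z, P c} : Language α) := by
  refine isRegular_of_leftQuotient_mem (S := {{z | ∀ c ∈ z, P c}, (∅ : Set (List α))})
    ((finite_singleton _).insert _) (.inl rfl) ?_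
  rintro _ (rfl | rfl) a
  · by_cases ha : P a
    · refine .inl (Set.ext fun z => ?_)
      change (∀ c ∈ a :: z, P c) ↔ ∀ c ∈ z, P c
      simp [ha]
    · refine .inr (Set.ext fun z => ?_)
      change (∀ c ∈ a :: z, P c) ↔ False
      simp [ha]
  · exact .inr rfl

theorem isRegular_head (P : Option α → Prop) :
    Language.IsRegular ({z | P z.head?} : Language α) := by
  refine isRegular_of_leftQuotient_mem
    (S := {{z | P z.head?}, (∅ : Set (List α)), (univ : Set (List α))})
    (((finite_singleton _).insert _).insert _) (.inl rfl) ?_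
  rintro _ (rfl | rfl | rfl) a
  · by_cases ha : P (some a)
    · refine .inr (.inr (Set.ext fun z => ?_))
      change P (some a) ↔ True
      simp [ha]
    · refine .inr (.inl (Set.ext fun z => ?_))
      change P (some a) ↔ False
      simp [ha]
  · exact .inr (.inl rfl)
  · exact .inr (.inr rfl)

theorem isRegular_iUnion {ι : Type*} [Finite ι] {L : ι → Language α} (h : ∀ i, (L i).IsRegular) :
    Language.IsRegular ({z | ∃ i, z ∈ L i} : Language α) := by
  have := IsRational.iUnion fun i => isRegular_iff_isRational.1 (h i)
  refine isRegular_of_mem_iff this.range fun v => ?_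
  constructor
  · rintro ⟨i, hi⟩
    exact ⟨[], mem_iUnion.2 ⟨i, rfl, hi⟩⟩
  · rintro ⟨u, hu⟩
    obtain ⟨i, -, hi⟩ := mem_iUnion.1 hu
    exact ⟨i, hi⟩

theorem isRegular_and {P P' : List α → Prop} (h : Language.IsRegular ({z | P z} : Language α))
    (h' : Language.IsRegular ({z | P' z} : Language α)) :
    Language.IsRegular ({z | P z ∧ P' z} : Language α) :=
  isRegular_of_mem_iff (h.inf h') fun _ => Iff.rfl

/-- A pair of words of equal length is the same as one word of pairs, so a length-preserving
relation can be tested by an ordinary automaton. -/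
theorem isRational_of_length_eq {R : Set (List α × List β)}
    (hR : ∀ p ∈ R, p.1.length = p.2.length)
    (h : Language.IsRegular ({z | (z.map Prod.fst, z.map Prod.snd) ∈ R} : Language (α × β))) :
    IsRational R := by
  convert isRational_sync h using 1
  ext ⟨u, v⟩
  constructor
  · intro huv
    have hl : u.length = v.length := hR _ huv
    refine ⟨u.zip v, ?_, ?_⟩
    · change (_, _) ∈ R
      rwa [List.map_fst_zip hl.le, List.map_snd_zip hl.ge]
    · rw [List.map_fst_zip hl.le, List.map_snd_zip hl.ge]
  · rintro ⟨z, hz, h⟩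
    rw [h]
    exact hz

/-- Words of pairs whose tracks agree up to expansions `g` and `f` of their letters, where `q` has
been read ahead on the first track, and the second track is followed by `n` letters `s`. -/
def delayLang (f g : α → List α) (s : α) (n : ℕ) (q : List α) : Language (α × α) :=
  {z | q ++ (z.map Prod.fst).flatMap g = (z.map Prod.snd).flatMap f ++ List.replicate n s}

theorem mem_delayLang {f g : α → List α} {s : α} {n : ℕ} {q : List α} {z : List (α × α)} :
    z ∈ delayLang f g s n q ↔
      q ++ (z.map Prod.fst).flatMap g = (z.map Prod.snd).flatMap f ++ List.replicate n s :=
  Iff.rfl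

theorem length_flatMap_le {f : α → List β} (hf : ∀ b, (f b).length ≤ 1) (u : List α) :
    (u.flatMap f).length ≤ u.length := by
  induction u with
  | nil => simp
  | cons a u ih => simp only [List.flatMap_cons, List.length_append, List.length_cons]; grind

theorem le_length_flatMap {g : α → List β} (hg : ∀ b, 1 ≤ (g b).length) (u : List α) :
    u.length ≤ (u.flatMap g).length := by
  induction u with
  | nil => simp
  | cons a u ih => simp only [List.flatMap_cons, List.length_append, List.length_cons]; grind

/-- The left quotients are again delay languages, with an updated buffer `q`, or empty. Since `g`
never shortens and `f` never lengthens, a buffer longer than `n` cannot be emptied any more, so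
finitely many quotients remain. -/
theorem isRegular_delayLang [Finite α] {f g : α → List α} (hf : ∀ b, (f b).length ≤ 1)
    (hg : ∀ b, 1 ≤ (g b).length) (s : α) (n : ℕ) : (delayLang f g s n []).IsRegular := by
  refine isRegular_of_leftQuotient_mem
    (S := insert (∅ : Set _) (delayLang f g s n '' {q | q.length ≤ n}))
    ((List.finite_length_le α n).image _ |>.insert _) (.inr ⟨[], by simp, rfl⟩) ?_
  have empty_of_lt : ∀ q : List α, n < q.length → delayLang f g s n q = (∅ : Set _) := by
    refine fun q hq => Set.eq_empty_of_forall_notMem fun z hz => ?_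
    have := congrArg List.length (mem_delayLang.1 hz)
    have h₁ := length_flatMap_le hf (z.map Prod.snd)
    have h₂ := le_length_flatMap hg (z.map Prod.fst)
    simp only [List.length_append, List.length_replicate, List.length_map] at this h₁ h₂
    omega
  rintro _ (rfl | ⟨q, -, rfl⟩) ⟨a, b⟩
  · exact .inl rfl
  -- Reading `(a, b)` appends `g a` to the buffer and consumes `f b` from its front. Consuming is
  -- the only possibility because `f b` is not longer than `g a`.
  · by_cases h : f b <+: q ++ g a
    · obtain ⟨q', hq'⟩ := h
      have : (delayLang f g s n q).leftQuotient [(a, b)] = delayLang f g s n q' := by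
        ext z
        simp [Language.mem_leftQuotient, mem_delayLang, ← List.append_assoc, ← hq']
        simp
      rw [this]
      by_cases hl : q'.length ≤ n
      · exact .inr ⟨q', hl, rfl⟩
      · exact .inl (empty_of_lt q' (not_le.1 hl))
    · refine .inl (Set.eq_empty_of_forall_notMem fun z hz => h ?_)
      have := (mem_delayLang (z := (a, b) :: z)).1 hz
      simp only [List.map_cons, List.flatMap_cons, ← List.append_assoc]
        at this
      rw [List.append_assoc (f b)] at this
      refine List.prefix_of_prefix_length_le (l₃ := f b ++ _) ⟨_, rfl⟩ ⟨_, this⟩ ?_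
      have := hf b
      have := hg a
      simp only [List.length_append]
      omega

end Sync

/-! ### Rationality of the rule relations -/

section Rules

variable {A : Type*} {V : Type*}

/-- The counts of symbols in terms compare elements of the sum by `==`; lemmas on `List.count` need
this to be equality. -/
instance [BEq A] [BEq V] [LawfulBEq A] [LawfulBEq V] : LawfulBEq (A ⊕ V) where
  rfl := by rintro (a | a) <;> exact beq_self_eq_true a
  eq_of_beq := by
    rintro (a | a) (b | b) h
    · exact congrArg _ (eq_of_beq (α := A) h)
    · cases h
    · cases h
    · exact congrArg _ (eq_of_beq (α := V) h)

instance [Finite A] [Finite V] : Finite (Letter A V) :=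
  .of_injective (β := Option (Cell A V))
    (fun | .cell c => some c | .delim => none) (by rintro (_ | _) (_ | _) h <;> simp_all)

theorem isRational_padRel : IsRational (padRel (A := A) (V := V)) := by
  have h₁ : IsRational {p : List (Cell A V) × List (Cell A V) | p.1 = p.2} :=
    isRational_of_length_eq (fun _ h => congrArg _ h)
      (isRegular_of_mem_iff (isRegular_forall_mem fun c => c.1 = c.2) fun z => by
        change z.map _ = z.map _ ↔ ∀ c ∈ z, _
        rw [List.map_inj_left])
  have h₂ := (isRational_singleton_toList (none : Option (Cell A V))
    (some ((none, none) : Cell A V))).star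
  convert h₁.concat h₂ using 1
  ext ⟨u, v⟩
  rw [mem_relConcat]
  constructor
  · rintro ⟨k, h⟩
    obtain rfl : v = u ++ _ := h
    refine ⟨u, u, [], _, rfl, ?_, by simp, rfl⟩
    induction k with
    | zero => exact nil_mem_relStar _
    | succ k ih => exact append_mem_relStar (u₁ := []) (v₁ := [(none, none)]) rfl ih
  · rintro ⟨u₁, v₁, u₂, v₂, h₁, h₂, rfl, rfl⟩
    obtain rfl : u₁ = v₁ := h₁
    obtain ⟨rfl, k, rfl⟩ := relStar_induction
      (M := fun u₂ v₂ => u₂ = [] ∧ ∃ k, v₂ = List.replicate k ((none, none) : Cell A V))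
      ⟨rfl, 0, rfl⟩ (by
        rintro _ _ _ _ h ⟨rfl, k, rfl⟩
        obtain ⟨rfl, rfl⟩ := Prod.mk.inj h
        exact ⟨rfl, k + 1, rfl⟩) h₂
    exact ⟨k, by simp⟩

variable [DecidableEq A] [DecidableEq V]

/-- Substitution of a single track symbol by a rule. -/
def Rule.expand (ρ : Rule A V) (c : PadSym A V) : List (PadSym A V) :=
  if c = some (.inr ρ.var) then ρ.replacement.map some else [c]

theorem Rule.length_flatMap_expand_prepend (x : V) (α : A ⊕ V) (u : List (PadSym A V)) :
    (u.flatMap (Rule.prepend x α).expand).length = u.length + u.count (some (.inr x)) := by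
  induction u with
  | nil => rfl
  | cons c u ih =>
    rw [List.flatMap_cons, List.length_append, ih, List.count_cons, List.length_cons]
    by_cases h : c = some (.inr x) <;> simp [Rule.expand, Rule.var, Rule.replacement, h] <;> omega

theorem Rule.flatMap_expand_erase (x : V) (u : List (PadSym A V)) :
    u.flatMap (Rule.erase x : Rule A V).expand =
      u.filter fun c => decide (c ≠ some (Sum.inr x)) := by
  induction u with
  | nil => rfl
  | cons c u ih =>
    rw [List.flatMap_cons, ih, List.filter_cons]
    by_cases h : c = some (Sum.inr x) <;> simp [Rule.expand, Rule.var, Rule.replacement, h]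

theorem length_filter_ne_add_count {α : Type*} [BEq α] [LawfulBEq α] [DecidableEq α]
    (a : α) (u : List α) :
    (u.filter fun c => decide (c ≠ a)).length + u.count a = u.length := by
  induction u with
  | nil => rfl
  | cons c u ih =>
    rw [List.filter_cons, List.count_cons]
    by_cases h : c = a <;> simp [h] <;> simp at ih <;> omega

theorem Rule.flatMap_expand_replicate_none (ρ : Rule A V) (n : ℕ) :
    (List.replicate n none).flatMap ρ.expand = List.replicate n none := by
  induction n with
  | zero => rfl
  | succ n ih => rw [List.replicate_succ, List.flatMap_cons, ih]; simp [Rule.expand]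

/-- An expanded variable ends in `x`, not in `#`. Final paddings of the expansion therefore come
from final paddings of `u`, which are peeled off from the right. -/
theorem Rule.exists_of_flatMap_expand_prepend {x : V} {α : A ⊕ V} {n : ℕ}
    {u v : List (PadSym A V)}
    (h : u.flatMap (Rule.prepend x α).expand = v ++ List.replicate n none) :
    ∃ w, u = w ++ List.replicate n none ∧ v = w.flatMap (Rule.prepend x α).expand := by
  induction n generalizing u with
  | zero => exact ⟨u, by simp, by simpa using h.symm⟩
  | succ n ih =>
    rcases List.eq_nil_or_concat' u with rfl | ⟨u, c, rfl⟩
    · simp at h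
    · rw [List.replicate_succ', ← List.append_assoc] at h
      by_cases hc : c = some (.inr x)
      · simp only [List.flatMap_append, List.flatMap_singleton, Rule.expand, Rule.var,
          Rule.replacement, hc, if_true] at h
        rw [show List.map some [α, Sum.inr x] = [some α] ++ [some (Sum.inr x)] from rfl,
          ← List.append_assoc] at h
        have := List.append_inj_right' h rfl
        simp at this
      · have hs : (Rule.prepend x α).expand c = [c] := by simp [Rule.expand, Rule.var, hc]
        rw [List.flatMap_append, List.flatMap_singleton, hs] at h
        obtain ⟨h₁, h₂⟩ := List.append_inj' h rfl
        obtain ⟨w, rfl, rfl⟩ := ih h₁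
        exact ⟨w, by rw [h₂, List.replicate_succ', List.append_assoc], rfl⟩

/-- The expansion lengthens `u` by its number of occurrences of `x`, so equality of lengths encodes
that this number is `n`. The right-hand side has the form of a delay language. -/
theorem mem_trackSubst_prepend {x : V} {α : A ⊕ V} {n : ℕ} {u v : List (PadSym A V)} :
    (u, v) ∈ trackSubst (Rule.prepend x α) n ↔
      u.length = v.length ∧
        u.flatMap (Rule.prepend x α).expand = v ++ List.replicate n none := by
  have hlen := Rule.length_flatMap_expand_prepend x α u
  change (u.count (some (.inr x)) = n ∧ ∃ w, u = w ++ List.replicate n none ∧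
    v = w.flatMap (Rule.prepend x α).expand) ↔ _
  constructor
  · rintro ⟨hn, w, rfl, rfl⟩
    have h : (w ++ List.replicate n none).flatMap (Rule.prepend x α).expand =
        w.flatMap (Rule.prepend x α).expand ++ List.replicate n none := by
      rw [List.flatMap_append, Rule.flatMap_expand_replicate_none]
    refine ⟨?_, h⟩
    rw [h, hn] at hlen
    simpa using hlen.symm
  · rintro ⟨hl, h⟩
    refine ⟨?_, Rule.exists_of_flatMap_expand_prepend h⟩
    rw [h, List.length_append, List.length_replicate] at hlen
    omega

theorem mem_trackSubst_erase {x : V} {n : ℕ} {u v : List (PadSym A V)} :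
    (u, v) ∈ trackSubst (Rule.erase x : Rule A V) n ↔
      u.length = v.length ∧
        v = u.flatMap (Rule.erase x : Rule A V).expand ++ List.replicate n none := by
  have hlen := length_filter_ne_add_count (some (.inr x)) u
  rw [Rule.flatMap_expand_erase]
  change (u.count (some (.inr x)) = n ∧ v = _) ↔ _
  refine and_congr_left fun h => ?_
  change v = u.filter (fun c => decide (c ≠ some (Sum.inr x))) ++ List.replicate n none at h
  rw [h, List.length_append, List.length_replicate]
  constructor
  · intro h
    change _ = u.length at hlen
    change u.count _ = n at h
    omega
  · intro h
    change u.count _ = n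
    omega

theorem length_eq_of_mem_trackSubst {ρ : Rule A V} {n : ℕ} {p}
    (h : p ∈ trackSubst ρ n) : p.1.length = p.2.length := by
  cases ρ with
  | prepend x α => exact (mem_trackSubst_prepend.1 h).1
  | erase x => exact (mem_trackSubst_erase.1 h).1

theorem length_eq_of_mem_substRel {ρ : Rule A V} {n : ℕ} {p}
    (h : p ∈ substRel ρ n) : p.1.length = p.2.length := by
  obtain ⟨m, -, k, -, h, -⟩ := h
  simpa using length_eq_of_mem_trackSubst h

/-- State `false` skips letters `[β;β]` and state `true` copies. Both are final because the whole
word may be trimmed away. -/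
theorem isRational_trimRel : IsRational (trimRel (A := A) (V := V)) := by
  let T : Transducer (Cell A V) (Cell A V) Bool :=
    { trans := fun q a b r => ∃ c, a = some c ∧
        (q = false ∧ r = false ∧ c.1 = c.2 ∧ b = none ∨
          (q = false → c.1 ≠ c.2) ∧ r = true ∧ b = some c)
      initial := {false}
      final := univ }
  have h_true : ∀ u, T.Acc true u u := by
    intro u
    induction u with
    | nil => exact .nil trivial
    | cons c u ih =>
      exact .step (a := some c) (b := some c) ⟨c, rfl, .inr ⟨by simp, rfl, rfl⟩⟩ ih
  refine isRational_of_finite T fun u v => ?_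
  constructor
  · rintro h
    obtain rfl : v = u.dropWhile _ := h
    refine ⟨false, rfl, ?_⟩
    induction u with
    | nil => exact .nil trivial
    | cons c u ih =>
      by_cases hc : c.1 = c.2
      · rw [List.dropWhile_cons_of_pos (by simpa using hc)]
        exact .step (a := some c) (b := none) ⟨c, rfl, .inl ⟨rfl, rfl, hc, rfl⟩⟩ ih
      · rw [List.dropWhile_cons_of_neg (by simpa using hc)]
        exact .step (a := some c) (b := some c) ⟨c, rfl, .inr ⟨fun _ => hc, rfl, rfl⟩⟩ (h_true u)
  · rintro ⟨_, rfl, hacc⟩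
    refine Transducer.Acc.induct (T := T) (M := fun q u v => bif q then v = u else (u, v) ∈ trimRel)
      ?_ ?_ hacc
    · rintro (_ | _) - <;> rfl
    · rintro q _ _ _ u v ⟨c, rfl, ⟨rfl, rfl, hc, rfl⟩ | ⟨hq, rfl, rfl⟩⟩ - h
      · refine .trans h ?_
        exact (List.dropWhile_cons_of_pos (by simpa using hc)).symm
      · obtain rfl : v = u := h
        cases q with
        | true => rfl
        | false => exact (List.dropWhile_cons_of_neg (by simpa using hq rfl)).symm

variable [Finite A] [Finite V]

theorem isRegular_trackSubst (ρ : Rule A V) (n : ℕ) :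
    Language.IsRegular ({z | (z.map Prod.fst, z.map Prod.snd) ∈ trackSubst ρ n} :
      Language (PadSym A V × PadSym A V)) := by
  cases ρ with
  | prepend x α =>
    refine isRegular_of_mem_iff (isRegular_delayLang (f := fun c => [c])
      (g := (Rule.prepend x α).expand) (by simp) ?_ none n) fun z => ?_
    · intro b
      unfold Rule.expand
      split_ifs <;> simp [Rule.replacement]
    · refine (mem_trackSubst_prepend).trans ?_
      simp [mem_delayLang]
  | erase x =>
    -- For `x ↦ ε` it is the output track that is ahead, hence the exchange of the two tracks.
    refine isRegular_of_mem_iff (isRegular_comap (isRegular_delayLang (g := fun c => [c])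
      (f := (Rule.erase x : Rule A V).expand) ?_ (by simp) none n) Prod.swap) fun z => ?_
    · intro b
      unfold Rule.expand
      split_ifs <;> simp [Rule.replacement]
    · refine (mem_trackSubst_erase).trans (.trans ?_ mem_delayLang.symm)
      rw [List.map_map, List.map_map]
      simp [Function.comp_def]

/-- A finite union over the splittings of the occurrence count; each track condition is pulled back
along the projection to that track. -/
theorem isRegular_substRel (ρ : Rule A V) (n : ℕ) :
    Language.IsRegular ({z | (z.map Prod.fst, z.map Prod.snd) ∈ substRel ρ n} :
      Language (Cell A V × Cell A V)) := by
  refine isRegular_of_mem_iff (isRegular_iUnion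
    (ι := {p : Fin (n + 1) × Fin (n + 1) // p.2 ≤ p.1}) fun p =>
    isRegular_and (isRegular_comap (isRegular_trackSubst ρ p.1.2.val)
      fun c : Cell A V × Cell A V => (c.1.1, c.2.1))
    (isRegular_comap (isRegular_trackSubst ρ (p.1.1.val - p.1.2.val))
      fun c : Cell A V × Cell A V => (c.1.2, c.2.2))) fun z => ?_
  have key : ∀ m k, ((z.map fun c : Cell A V × Cell A V => (c.1.1, c.2.1)) ∈
        ({z | (z.map Prod.fst, z.map Prod.snd) ∈ trackSubst ρ k} :
          Language (PadSym A V × PadSym A V)) ∧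
      (z.map fun c : Cell A V × Cell A V => (c.1.2, c.2.2)) ∈
        ({z | (z.map Prod.fst, z.map Prod.snd) ∈ trackSubst ρ (m - k)} :
          Language (PadSym A V × PadSym A V))) ↔
      ((z.map Prod.fst).map Prod.fst, (z.map Prod.snd).map Prod.fst) ∈ trackSubst ρ k ∧
      ((z.map Prod.fst).map Prod.snd, (z.map Prod.snd).map Prod.snd) ∈ trackSubst ρ (m - k) := by
    intro m k
    change ((z.map _).map _, (z.map _).map _) ∈ trackSubst ρ k ∧
      ((z.map _).map _, (z.map _).map _) ∈ trackSubst ρ (m - k) ↔ _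
    simp only [List.map_map]
    rfl
  constructor
  · rintro ⟨m, hm, k, hk, h⟩
    exact ⟨⟨(⟨m, by omega⟩, ⟨k, by omega⟩), hk⟩, (key m k).2 h⟩
  · rintro ⟨⟨⟨⟨m, hm⟩, ⟨k, hk⟩⟩, hkm⟩, h⟩
    exact ⟨m, by omega, k, hkm, (key m k).1 h⟩

theorem isRational_substRel (ρ : Rule A V) (n : ℕ) : IsRational (substRel ρ n) :=
  isRational_of_length_eq (fun _ => length_eq_of_mem_substRel) (isRegular_substRel ρ n)

theorem isRational_guard_substRel (ρ : Rule A V) (n : ℕ) :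
    IsRational {p : List (Cell A V) × List (Cell A V) |
      ρ.Guard some (p.1.head?.map Prod.fst) (p.1.head?.map Prod.snd) ∧ p ∈ substRel ρ n} := by
  have h := isRegular_and (isRegular_head fun c : Option (Cell A V × Cell A V) =>
    ρ.Guard some (c.map fun c => c.1.1) (c.map fun c => c.1.2)) (isRegular_substRel ρ n)
  refine isRational_of_length_eq (fun p (h : _ ∧ p ∈ substRel ρ n) => length_eq_of_mem_substRel h.2)
    (isRegular_of_mem_iff h fun z => ?_)
  change ρ.Guard some ((z.map _).head?.map _) ((z.map _).head?.map _) ∧ _ ↔ _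
  rw [List.head?_map, Option.map_map, Option.map_map]
  rfl

theorem isRational_ruleRel (ρ : Rule A V) (n : ℕ) : IsRational (ruleRel ρ n) :=
  isRational_trimRel.comp (isRational_guard_substRel ρ n)

theorem isRational_ruleSeqRel (ρ : Rule A V) (n : ℕ) : IsRational (ruleSeqRel ρ n) := by
  refine .concat (.star ?_) (.concat ((isRational_ruleRel ρ n).map _ _)
    (.star (.concat ?_ ((isRational_trimRel.comp (isRational_substRel ρ n)).map _ _))))
  · exact (isRational_singleton_toList (some padLetter) (some padLetter)).union
      (isRational_singleton_toList (some Letter.delim) (some Letter.delim))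
  · exact isRational_singleton_toList (some Letter.delim) (some Letter.delim)

end Rules

/-! ### Deletion of paddings -/

section PadDeletion

variable {A : Type*} {V : Type*}

/-- Deletion of arbitrarily many letters `[#;#]`. -/
def padDelRel : Set (List (Letter A V) × List (Letter A V)) :=
  relStar ((⋃ c : Letter A V, {([c], [c])}) ∪ {([padLetter], [])})

theorem isRational_padDelRel [Finite A] [Finite V] : IsRational (padDelRel (A := A) (V := V)) :=
  .star (.union (.iUnion fun c => isRational_singleton_toList (some c) (some c))
    (isRational_singleton_toList (some padLetter) none))

theorem padDelRel_cons (c : Letter A V) {w z} (h : (w, z) ∈ padDelRel) :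
    (c :: w, c :: z) ∈ padDelRel :=
  append_mem_relStar (u₁ := [c]) (v₁ := [c]) (.inl (mem_iUnion.2 ⟨c, rfl⟩)) h

theorem padDelRel_pad {w z : List (Letter A V)} (h : (w, z) ∈ padDelRel) :
    (padLetter :: w, z) ∈ padDelRel :=
  append_mem_relStar (u₁ := [padLetter]) (v₁ := []) (.inr rfl) h

theorem padDelRel_induction {M : List (Letter A V) → List (Letter A V) → Prop} (nil : M [] [])
    (cons : ∀ c w z, M w z → M (c :: w) (c :: z))
    (pad : ∀ w z, M w z → M (padLetter :: w) z)
    {w z} (h : (w, z) ∈ padDelRel) : M w z := by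
  refine relStar_induction nil ?_ h
  rintro _ _ _ _ (h | h) ih
  · obtain ⟨c, h⟩ := mem_iUnion.1 h
    obtain ⟨rfl, rfl⟩ := Prod.mk.inj h
    exact cons _ _ _ ih
  · obtain ⟨rfl, rfl⟩ := Prod.mk.inj h
    exact pad _ _ ih

theorem padDelRel_append (u : List (Letter A V)) {w z} (h : (w, z) ∈ padDelRel) :
    (u ++ w, u ++ z) ∈ padDelRel := by
  induction u with
  | nil => exact h
  | cons c u ih => exact padDelRel_cons c ih

theorem padDelRel_replicate (n : ℕ) {w z : List (Letter A V)} (h : (w, z) ∈ padDelRel) :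
    (List.replicate n padLetter ++ w, z) ∈ padDelRel := by
  induction n with
  | zero => exact h
  | succ n ih => exact padDelRel_pad ih

/-- Saturation deletes arbitrary individual paddings, which is a rational operation and allows
induction letter by letter. -/
theorem mem_saturBullet {L : Language (Letter A V)} {z : List (Letter A V)} :
    z ∈ saturBullet L ↔ ∃ w ∈ L, (w, z) ∈ padDelRel := by
  constructor
  · rintro ⟨w, hw, u₁, us, rfl, rfl⟩
    refine ⟨_, hw, padDelRel_append _ ?_⟩
    clear hw
    induction us with
    | nil => exact nil_mem_relStar _
    | cons p us ih =>
      rw [List.flatMap_cons, List.flatMap_cons, List.append_assoc]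
      exact padDelRel_replicate _ (padDelRel_append _ ih)
  · rintro ⟨w, hw, h⟩
    refine ⟨w, hw, ?_⟩
    refine padDelRel_induction (M := fun w z => ∃ (u₁ : List (Letter A V))
      (us : List (ℕ × List (Letter A V))),
      w = u₁ ++ us.flatMap (fun p => List.replicate (p.1 + 1) padLetter ++ p.2) ∧
      z = u₁ ++ us.flatMap (fun p => p.2)) ⟨[], [], rfl, rfl⟩ ?_ ?_ h
    · rintro c _ _ ⟨u₁, us, rfl, rfl⟩
      exact ⟨c :: u₁, us, rfl, rfl⟩
    · rintro _ _ ⟨u₁, us, rfl, rfl⟩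
      -- The deleted padding becomes a gap of length one (`0` stands for one letter) after an empty
      -- first factor.
      exact ⟨[], (0, u₁) :: us, rfl, rfl⟩

theorem isRegular_saturBullet [Finite A] [Finite V] {L : Language (Letter A V)}
    (h : L.IsRegular) : (saturBullet L).IsRegular :=
  isRegular_of_mem_iff (isRational_padDelRel.relImage h) fun _ => mem_saturBullet

end PadDeletion

/-! ### Regularity of encodings -/

section Encodings

variable {A : Type*} {V : Type*} [DecidableEq A] [DecidableEq V]

theorem mem_encodeSystem_nil {w : List (Letter A V)} :
    w ∈ encodeSystem ([] : System A V) ↔ w = [] := by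
  constructor
  · rintro ⟨_, h, rfl⟩
    cases h
    rfl
  · rintro rfl
    exact ⟨[], .nil, rfl⟩

theorem mem_encodeSystem_singleton {e : Equation A V} {w : List (Letter A V)} :
    w ∈ encodeSystem [e] ↔ ∃ x ∈ encode e, w = x.map Letter.cell := by
  constructor
  · rintro ⟨_, _ | ⟨hx, _ | _⟩, rfl⟩
    exact ⟨_, hx, by simp⟩
  · rintro ⟨x, hx, rfl⟩
    exact ⟨[x], .cons hx .nil, by simp⟩

theorem mem_encodeSystem_cons_cons {e e' : Equation A V} {Φ : System A V}
    {w : List (Letter A V)} :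
    w ∈ encodeSystem (e :: e' :: Φ) ↔
      ∃ x ∈ encode e, ∃ w' ∈ encodeSystem (e' :: Φ), w = x.map Letter.cell ++ .delim :: w' := by
  constructor
  · rintro ⟨_, _ | ⟨hx, _ | ⟨hx', h⟩⟩, rfl⟩
    exact ⟨_, hx, _, ⟨_, .cons hx' h, rfl⟩, by simp [List.intercalate]⟩
  · rintro ⟨x, hx, _, ⟨_, h, rfl⟩, rfl⟩
    refine ⟨_, .cons hx h, ?_⟩
    cases h
    simp [List.intercalate]

theorem isRegular_encode (e : Equation A V) : (encode e).IsRegular :=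
  (isRational_trimRel.comp isRational_padRel).relImage (isRegular_singleton _)

theorem isRegular_encodeSystem (Φ : System A V) : (encodeSystem Φ).IsRegular := by
  induction Φ with
  | nil => exact isRegular_of_mem_iff (isRegular_singleton []) fun _ => mem_encodeSystem_nil
  | cons e Φ ih =>
    have he := isRegular_map (isRegular_encode e) (Letter.cell (A := A) (V := V))
    cases Φ with
    | nil =>
      refine isRegular_of_mem_iff he fun w => mem_encodeSystem_singleton.trans ?_
      exact ⟨fun ⟨x, hx, h⟩ => ⟨x, hx, h.symm⟩, fun ⟨x, hx, h⟩ => ⟨x, hx, h.symm⟩⟩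
    | cons e' Φ =>
      refine isRegular_of_mem_iff (isRegular_mul he
        (isRegular_mul (isRegular_singleton [.delim]) ih))
        fun w => mem_encodeSystem_cons_cons.trans ?_
      simp only [Language.mem_mul]
      constructor
      · rintro ⟨x, hx, w', hw', rfl⟩
        exact ⟨_, ⟨x, hx, rfl⟩, _, ⟨_, rfl, w', hw', rfl⟩, rfl⟩
      · rintro ⟨_, ⟨x, hx, rfl⟩, _, ⟨_, rfl, w', hw', rfl⟩, rfl⟩
        exact ⟨x, hx, w', hw', rfl⟩

variable [Finite A] [Finite V]

theorem isEffective_quadraticProblem (Φ : System A V) : (quadraticProblem Φ).IsEffective :=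
  ⟨isRegular_encodeSystem Φ,
    .iUnion fun _ => .iUnion fun _ => isRational_ruleSeqRel _ _,
    .iUnion fun _ => isRational_ruleSeqRel _ _,
    isRegular_forall_mem _⟩

theorem isRegular_reach (Φ : System A V) (i : ℕ) : ((quadraticProblem Φ).reach i).IsRegular := by
  obtain ⟨h, h₁, h₂, -⟩ := isEffective_quadraticProblem Φ
  induction i with
  | zero => exact h
  | succ i ih => exact isRegular_saturBullet ((h₁.union h₂).relImage ih)

end Encodings

section EquationEncodings

variable {A : Type*} {V : Type*}

/-! ### Encodings of single equations -/

theorem map_fst_eqEncode (s t : Term A V) :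
    ∃ i, (eqEncode s t).map Prod.fst = s.map some ++ List.replicate i none := by
  induction s, t using eqEncode.induct with
  | case1 => exact ⟨0, by simp [eqEncode]⟩
  | case2 a s ih => obtain ⟨i, hi⟩ := ih; exact ⟨i, by simp [eqEncode, hi]⟩
  | case3 b t ih =>
    obtain ⟨i, hi⟩ := ih
    exact ⟨i + 1, by simpa [eqEncode, List.replicate_succ] using hi⟩
  | case4 a s b t ih => obtain ⟨i, hi⟩ := ih; exact ⟨i, by simp [eqEncode, hi]⟩

theorem map_snd_eqEncode (s t : Term A V) :
    ∃ i, (eqEncode s t).map Prod.snd = t.map some ++ List.replicate i none := by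
  induction s, t using eqEncode.induct with
  | case1 => exact ⟨0, by simp [eqEncode]⟩
  | case2 a s ih =>
    obtain ⟨i, hi⟩ := ih
    exact ⟨i + 1, by simpa [eqEncode, List.replicate_succ] using hi⟩
  | case3 b t ih => obtain ⟨i, hi⟩ := ih; exact ⟨i, by simp [eqEncode, hi]⟩
  | case4 a s b t ih => obtain ⟨i, hi⟩ := ih; exact ⟨i, by simp [eqEncode, hi]⟩

/-- Lets the two tracks be transformed separately: once both have the form term plus padding, their
pairing is again an encoding, up to a common padding. -/
theorem eq_eqEncode_append_of_tracks {s t : Term A V} {x : List (Cell A V)} {i j : ℕ}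
    (h₁ : x.map Prod.fst = s.map some ++ List.replicate i none)
    (h₂ : x.map Prod.snd = t.map some ++ List.replicate j none) :
    ∃ k, x = eqEncode s t ++ List.replicate k (none, none) := by
  induction x generalizing s t i j with
  | nil =>
    obtain ⟨rfl, -⟩ : s = [] ∧ _ := by simpa using h₁
    obtain ⟨rfl, -⟩ : t = [] ∧ _ := by simpa using h₂
    exact ⟨0, by simp [eqEncode]⟩
  | cons c x ih =>
    obtain ⟨a, b⟩ := c
    have hs : s = [] ∧ a = none ∧ (∃ i', x.map Prod.fst = List.replicate i' none) ∨
        ∃ a' s', s = a' :: s' ∧ a = some a' ∧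
          x.map Prod.fst = s'.map some ++ List.replicate i none := by
      cases s with
      | nil =>
        cases i with
        | zero => simp at h₁
        | succ i => left; exact ⟨rfl, List.head_eq_of_cons_eq h₁, i, List.tail_eq_of_cons_eq h₁⟩
      | cons a' s => right; exact ⟨a', s, rfl, by simpa using h₁⟩
    have ht : t = [] ∧ b = none ∧ (∃ i', x.map Prod.snd = List.replicate i' none) ∨
        ∃ b' t', t = b' :: t' ∧ b = some b' ∧
          x.map Prod.snd = t'.map some ++ List.replicate j none := by
      cases t with
      | nil =>
        cases j with
        | zero => simp at h₂
        | succ j => left; exact ⟨rfl, List.head_eq_of_cons_eq h₂, j, List.tail_eq_of_cons_eq h₂⟩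
      | cons b' t => right; exact ⟨b', t, rfl, by simpa using h₂⟩
    rcases hs with ⟨rfl, rfl, i', hi⟩ | ⟨a', s', rfl, rfl, hs⟩ <;>
    rcases ht with ⟨rfl, rfl, j', hj⟩ | ⟨b', t', rfl, rfl, ht⟩
    · obtain ⟨k, rfl⟩ := ih (s := []) (t := []) hi hj
      exact ⟨k + 1, by simp [eqEncode, List.replicate_succ]⟩
    · obtain ⟨k, rfl⟩ := ih (s := []) hi ht
      exact ⟨k, by simp [eqEncode]⟩
    · obtain ⟨k, rfl⟩ := ih (t := []) hs hj
      exact ⟨k, by simp [eqEncode]⟩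
    · obtain ⟨k, rfl⟩ := ih hs ht
      exact ⟨k, by simp [eqEncode]⟩

/-- The equation that a word over the two-track alphabet encodes. -/
def decode (x : List (Cell A V)) : Equation A V :=
  ((x.map Prod.fst).reduceOption, (x.map Prod.snd).reduceOption)

theorem reduceOption_map_some_append {α : Type*} (s : List α) (i : ℕ) :
    (s.map some ++ List.replicate i none).reduceOption = s := by
  rw [List.reduceOption_append, List.reduceOption_replicate_none, List.append_nil]
  induction s with
  | nil => rfl
  | cons a s ih => simp [ih]

theorem decode_eqEncode (s t : Term A V) (k : ℕ) :
    decode (eqEncode s t ++ List.replicate k (none, none)) = (s, t) := by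
  obtain ⟨i, hi⟩ := map_fst_eqEncode s t
  obtain ⟨j, hj⟩ := map_snd_eqEncode s t
  simp only [decode, List.map_append, hi, hj, List.map_replicate, List.append_assoc,
    List.replicate_append_replicate, reduceOption_map_some_append]

theorem head?_eqEncode_append {e : Equation A V} (he : e ≠ ([], [])) (u : List (Cell A V)) :
    (eqEncode e.1 e.2 ++ u).head? = some (e.1.head?, e.2.head?) := by
  obtain ⟨_ | ⟨a, s⟩, _ | ⟨b, t⟩⟩ := e
  · exact absurd rfl he
  all_goals simp [eqEncode]

theorem Rule.guard_some_iff (ρ : Rule A V) (l r : Option (A ⊕ V)) :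
    ρ.Guard some (some l) (some r) ↔ ρ.Guard id l r := by
  cases ρ <;> simp [Rule.Guard]

theorem Rule.not_guard_none {S : Type*} (emb : A ⊕ V → S) (ρ : Rule A V) :
    ¬ ρ.Guard emb none none := by
  cases ρ <;> simp [Rule.Guard]

theorem padDelRel_refl (w : List (Letter A V)) : (w, w) ∈ padDelRel := by
  simpa using padDelRel_append w (nil_mem_relStar _)

variable [DecidableEq A] [DecidableEq V]

/-- Removal of the longest prefix of letters of the form `[β;β]`. -/
def trimCells (x : List (Cell A V)) : List (Cell A V) :=
  x.dropWhile fun c => decide (c.1 = c.2)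

theorem trimCells_replicate (k : ℕ) :
    trimCells (List.replicate k ((none, none) : Cell A V)) = [] := by
  rw [trimCells, List.dropWhile_eq_nil_iff]
  intro c hc
  obtain ⟨-, rfl⟩ := List.mem_replicate.1 hc
  simp

theorem mem_encode {e : Equation A V} {z : List (Cell A V)} :
    z ∈ encode e ↔ ∃ k, z = trimCells (eqEncode e.1 e.2 ++ List.replicate k (none, none)) := by
  constructor
  · rintro ⟨_, rfl, y, ⟨k, hk⟩, h⟩
    exact ⟨k, by rw [← hk]; exact h⟩
  · rintro ⟨k, rfl⟩
    exact ⟨_, rfl, _, ⟨k, rfl⟩, rfl⟩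

theorem trimEq_trimEq (s t : Term A V) :
    trimEq (trimEq s t).1 (trimEq s t).2 = trimEq s t := by
  induction s, t using trimEq.induct with
  | case1 s a t ih => simpa [trimEq] using ih
  | case2 a s b t h => simp [trimEq, h]
  | case3 s t h => rw [trimEq.eq_2 _ _ h, trimEq.eq_2 _ _ h]

theorem trimCells_eqEncode_trimEq (s t : Term A V) (k : ℕ) :
    trimCells (eqEncode s t ++ List.replicate k (none, none)) =
      trimCells (eqEncode (trimEq s t).1 (trimEq s t).2 ++ List.replicate k (none, none)) := by
  induction s, t using trimEq.induct with
  | case1 s a t ih => simpa [trimEq, eqEncode, trimCells] using ih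
  | case2 a s b t h => rw [trimEq, if_neg h]
  | case3 s t h => rw [trimEq.eq_2 _ _ h]

theorem encode_trimEq (e : Equation A V) : encode (trimEq e.1 e.2) = encode e := by
  ext z
  simp only [mem_encode]
  exact exists_congr fun k => by rw [trimCells_eqEncode_trimEq e.1 e.2]

theorem mem_encode_nil {z : List (Cell A V)} : z ∈ encode (([], []) : Equation A V) ↔ z = [] := by
  rw [mem_encode]
  simp [eqEncode, trimCells_replicate]

/-- Equal first symbols would be removed by trimming, making the first side strictly shorter. -/
theorem head?_ne_of_trimmed {e : Equation A V} (h : trimEq e.1 e.2 = e) (he : e ≠ ([], [])) :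
    e.1.head? ≠ e.2.head? := by
  obtain ⟨_ | ⟨a, s⟩, _ | ⟨b, t⟩⟩ := e
  · exact absurd rfl he
  · simp
  · simp
  · rintro hab
    obtain rfl : a = b := by simpa using hab
    have : ∀ s t : Term A V, (trimEq s t).1.length ≤ s.length := by
      intro s t
      induction s, t using trimEq.induct with
      | case1 s a t ih => simp only [trimEq, if_true, List.length_cons]; omega
      | case2 a s b t h => simp [trimEq, h]
      | case3 s t h => rw [trimEq.eq_2 _ _ h]
    have h' := this s t
    simp only [trimEq, if_true] at h
    rw [h] at h'
    simp at h'

/-- The first letter has two different components, so `T_trim` leaves the padded word unchanged. For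
the empty equation it would delete all paddings. -/
theorem mem_encode_of_trimmed {e : Equation A V} (h : trimEq e.1 e.2 = e) (he : e ≠ ([], []))
    {z : List (Cell A V)} :
    z ∈ encode e ↔ ∃ k, z = eqEncode e.1 e.2 ++ List.replicate k (none, none) := by
  rw [mem_encode]
  refine exists_congr fun k => ?_
  have h₁ := head?_eqEncode_append he (List.replicate k (none, none))
  have h₂ := head?_ne_of_trimmed h he
  generalize eqEncode e.1 e.2 ++ List.replicate k (none, none) = u at h₁
  cases u with
  | nil => simp at h₁
  | cons c u =>
    obtain rfl : c = _ := by simpa using h₁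
    rw [trimCells, List.dropWhile_cons_of_neg (by simpa using h₂)]

theorem exists_eq_of_mem_encode {e : Equation A V} (h : trimEq e.1 e.2 = e)
    {z : List (Cell A V)} (hz : z ∈ encode e) :
    ∃ k, z = eqEncode e.1 e.2 ++ List.replicate k (none, none) := by
  by_cases he : e = ([], [])
  · subst he
    rw [mem_encode_nil.1 hz]
    exact ⟨0, by simp [eqEncode]⟩
  · exact (mem_encode_of_trimmed h he).1 hz

theorem decode_of_mem_encode {e : Equation A V} {z : List (Cell A V)} (hz : z ∈ encode e) :
    decode z = trimEq e.1 e.2 := by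
  rw [← encode_trimEq] at hz
  obtain ⟨k, rfl⟩ := exists_eq_of_mem_encode (trimEq_trimEq e.1 e.2) hz
  exact decode_eqEncode _ _ _

theorem head?_of_mem_encode {e : Equation A V} (h : trimEq e.1 e.2 = e) (he : e ≠ ([], []))
    {z : List (Cell A V)} (hz : z ∈ encode e) : z.head? = some (e.1.head?, e.2.head?) := by
  obtain ⟨k, rfl⟩ := (mem_encode_of_trimmed h he).1 hz
  exact head?_eqEncode_append he _

theorem eq_nil_of_nil_mem_encode {e : Equation A V} (h : trimEq e.1 e.2 = e)
    (hz : [] ∈ encode e) : e = ([], []) := by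
  by_contra he
  simpa using head?_of_mem_encode h he hz

/-- Used to show that on encodings the passed prefix of a rule relation contains delimiters only. -/
theorem pad_cons_notMem_encode {e : Equation A V} {z : List (Cell A V)} :
    (none, none) :: z ∉ encode e := by
  rintro h
  obtain ⟨k, hk⟩ := mem_encode.1 h
  rw [trimCells] at hk
  have := List.head?_dropWhile_not (fun c : Cell A V => decide (c.1 = c.2))
    (eqEncode e.1 e.2 ++ List.replicate k (none, none))
  rw [← hk] at this
  simp at this

theorem guard_iff_of_mem_encode (ρ : Rule A V) {e : Equation A V} (h : trimEq e.1 e.2 = e)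
    {x : List (Cell A V)} (hx : x ∈ encode e) :
    ρ.Guard some (x.head?.map Prod.fst) (x.head?.map Prod.snd) ↔
      ρ.Guard id e.1.head? e.2.head? := by
  by_cases he : e = ([], [])
  · subst he
    rw [mem_encode_nil.1 hx]
    exact iff_of_false (Rule.not_guard_none _ ρ) (Rule.not_guard_none _ ρ)
  · rw [head?_of_mem_encode h he hx]
    exact ρ.guard_some_iff _ _

/-! ### Substitution on encodings of single equations -/

/-- The substitution of a rule on both sides of an equation. -/
def Rule.substEq (ρ : Rule A V) (e : Equation A V) : Equation A V :=
  (substTerm ρ.var ρ.replacement e.1, substTerm ρ.var ρ.replacement e.2)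

theorem Rule.flatMap_expand_map_some (ρ : Rule A V) (t : Term A V) :
    (t.map some).flatMap ρ.expand = (substTerm ρ.var ρ.replacement t).map some := by
  induction t with
  | nil => rfl
  | cons c t ih =>
    rw [List.map_cons, List.flatMap_cons, ih, substTerm, substTerm, List.flatMap_cons,
      List.map_append]
    congr 1
    by_cases hc : c = Sum.inr ρ.var <;> simp [Rule.expand, hc]

theorem eq_map_some_append_of_append {α : Type*} {s : List α} {i k : ℕ} {v : List (Option α)}
    (h : s.map some ++ List.replicate i none = v ++ List.replicate k none) :
    ∃ j, v = s.map some ++ List.replicate j none := by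
  induction k generalizing i with
  | zero => exact ⟨i, by simpa using h.symm⟩
  | succ k ih =>
    rw [List.replicate_succ', ← List.append_assoc] at h
    cases i with
    | zero =>
      have : none ∈ s.map some ++ List.replicate 0 none := by rw [h]; simp
      simp at this
    | succ i =>
      rw [List.replicate_succ', ← List.append_assoc] at h
      exact ih (List.append_inj_left' h rfl)

theorem trackSubst_map_some {ρ : Rule A V} {n i : ℕ} {t : Term A V} {v : List (PadSym A V)}
    (h : (t.map some ++ List.replicate i none, v) ∈ trackSubst ρ n) :
    ∃ j, v = (substTerm ρ.var ρ.replacement t).map some ++ List.replicate j none := by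
  have hu : (t.map some ++ List.replicate i none).flatMap ρ.expand =
      (substTerm ρ.var ρ.replacement t).map some ++ List.replicate i none := by
    rw [List.flatMap_append, ρ.flatMap_expand_map_some, ρ.flatMap_expand_replicate_none]
  cases ρ with
  | prepend x α =>
    have := (mem_trackSubst_prepend.1 h).2
    rw [hu] at this
    exact eq_map_some_append_of_append this
  | erase x =>
    have := (mem_trackSubst_erase.1 h).2
    rw [hu, List.append_assoc, List.replicate_append_replicate] at this
    exact ⟨_, this⟩

/-- The bound on `i` is needed for `y ↦ αy`, whose inserted symbols take the place of paddings. -/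
theorem exists_mem_trackSubst (ρ : Rule A V) {i : ℕ} {t : Term A V}
    (h : t.count (.inr ρ.var) ≤ i) :
    ∃ v, (t.map some ++ List.replicate i none, v) ∈ trackSubst ρ (t.count (.inr ρ.var)) := by
  have hc : (t.map some ++ List.replicate i none).count (some (Sum.inr ρ.var)) =
      t.count (Sum.inr ρ.var) := by
    rw [List.count_append, List.count_map_of_injective t some (Option.some_injective _),
      List.count_replicate]
    rfl
  cases ρ with
  | prepend x α =>
    refine ⟨_, hc, t.map some ++ List.replicate (i - t.count (.inr x)) none, ?_, rfl⟩
    rw [List.append_assoc, List.replicate_append_replicate]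
    exact congrArg (fun k => t.map some ++ List.replicate k none) (Nat.sub_add_cancel h).symm
  | erase x =>
    exact ⟨(t.map some ++ List.replicate i none).filter _ ++ List.replicate _ none, hc, rfl⟩

theorem substRel_eqEncode {ρ : Rule A V} {n k : ℕ} {e : Equation A V} {x' : List (Cell A V)}
    (h : (eqEncode e.1 e.2 ++ List.replicate k (none, none), x') ∈ substRel ρ n) :
    ∃ k', x' = eqEncode (ρ.substEq e).1 (ρ.substEq e).2 ++ List.replicate k' (none, none) := by
  obtain ⟨m, -, l, -, h₁, h₂⟩ := h
  obtain ⟨i, hi⟩ := map_fst_eqEncode e.1 e.2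
  obtain ⟨j, hj⟩ := map_snd_eqEncode e.1 e.2
  simp only [List.map_append, hi, hj, List.map_replicate, List.append_assoc,
    List.replicate_append_replicate] at h₁ h₂
  obtain ⟨i', hi'⟩ := trackSubst_map_some h₁
  obtain ⟨j', hj'⟩ := trackSubst_map_some h₂
  exact eq_eqEncode_append_of_tracks hi' hj'

theorem exists_mem_substRel (ρ : Rule A V) {n k : ℕ} {e : Equation A V}
    (hn : (e.1 ++ e.2).count (.inr ρ.var) ≤ n) (hk : n ≤ k) :
    ∃ x', (eqEncode e.1 e.2 ++ List.replicate k (none, none), x') ∈ substRel ρ n := by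
  obtain ⟨i, hi⟩ := map_fst_eqEncode e.1 e.2
  obtain ⟨j, hj⟩ := map_snd_eqEncode e.1 e.2
  rw [List.count_append] at hn
  obtain ⟨v₁, h₁⟩ := exists_mem_trackSubst ρ (t := e.1) (i := i + k) (by omega)
  obtain ⟨v₂, h₂⟩ := exists_mem_trackSubst ρ (t := e.2) (i := j + k) (by omega)
  have hu₁ : (eqEncode e.1 e.2 ++ List.replicate k (none, none)).map Prod.fst =
      e.1.map some ++ List.replicate (i + k) none := by
    simp only [List.map_append, hi, List.map_replicate, List.append_assoc,
      List.replicate_append_replicate]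
  have hu₂ : (eqEncode e.1 e.2 ++ List.replicate k (none, none)).map Prod.snd =
      e.2.map some ++ List.replicate (j + k) none := by
    simp only [List.map_append, hj, List.map_replicate, List.append_assoc,
      List.replicate_append_replicate]
  have hl₁ := length_eq_of_mem_trackSubst h₁
  have hl₂ := length_eq_of_mem_trackSubst h₂
  rw [← hu₁] at h₁ hl₁
  rw [← hu₂] at h₂ hl₂
  rw [List.length_map] at hl₁ hl₂
  have hl : v₁.length = v₂.length := hl₁.symm.trans hl₂
  refine ⟨v₁.zip v₂, _, hn, e.1.count (.inr ρ.var), by omega, ?_, ?_⟩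
  · simpa only [List.map_fst_zip hl.le] using h₁
  · simpa only [List.map_snd_zip hl.ge, Nat.add_sub_cancel_left] using h₂

theorem mem_encode_substEq {ρ : Rule A V} {n : ℕ} {e : Equation A V} (h : trimEq e.1 e.2 = e)
    {x x' : List (Cell A V)} (hx : x ∈ encode e)
    (hxx' : (x, x') ∈ relComp trimRel (substRel ρ n)) : x' ∈ encode (ρ.substEq e) := by
  obtain ⟨y, hy, hx'⟩ := hxx'
  obtain ⟨k, rfl⟩ := exists_eq_of_mem_encode h hx
  obtain ⟨k', rfl⟩ := substRel_eqEncode hy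
  exact mem_encode.2 ⟨k', hx'⟩

/-- If `u` is trimmed away entirely, so are the paddings in both words; otherwise trimming stops
inside `u` and the words differ only in final paddings. -/
theorem padDelRel_trimCells (u : List (Cell A V)) {k k' : ℕ} (h : k ≤ k') :
    ((trimCells (u ++ List.replicate k' (none, none))).map Letter.cell,
      (trimCells (u ++ List.replicate k (none, none))).map Letter.cell)
      ∈ padDelRel (A := A) (V := V) := by
  have hnil : ∀ k, ((List.replicate k ((none, none) : Cell A V)).dropWhile
      fun c => decide (c.1 = c.2)) = [] := trimCells_replicate
  unfold trimCells
  rw [List.dropWhile_append, List.dropWhile_append, hnil, hnil]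
  split_ifs
  · exact nil_mem_relStar _
  · rw [List.map_append, List.map_append, List.map_replicate, List.map_replicate]
    refine padDelRel_append _ ?_
    obtain ⟨d, rfl⟩ := Nat.exists_eq_add_of_le' h
    rw [← List.replicate_append_replicate]
    exact padDelRel_replicate d (padDelRel_refl _)

theorem exists_mem_encode_substEq {ρ : Rule A V} {n : ℕ} {e : Equation A V}
    (h : trimEq e.1 e.2 = e) (hn : (e.1 ++ e.2).count (.inr ρ.var) ≤ n)
    {z : List (Cell A V)} (hz : z ∈ encode (ρ.substEq e)) :
    ∃ x ∈ encode e, ∃ x', (x, x') ∈ relComp trimRel (substRel ρ n) ∧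
      (x'.map Letter.cell, z.map Letter.cell) ∈ padDelRel := by
  by_cases he : e = ([], [])
  · subst he
    rw [mem_encode_nil.1 hz]
    refine ⟨[], mem_encode_nil.2 rfl, [], ⟨[], ?_, rfl⟩, nil_mem_relStar _⟩
    refine ⟨0, Nat.zero_le _, 0, le_rfl, ?_⟩
    cases ρ with
    | prepend x α => exact ⟨⟨rfl, [], rfl, rfl⟩, rfl, [], rfl, rfl⟩
    | erase x => exact ⟨⟨rfl, rfl⟩, rfl, rfl⟩
  · obtain ⟨k, rfl⟩ := mem_encode.1 hz
    set u := eqEncode (ρ.substEq e).1 (ρ.substEq e).2 with hu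
    -- The `n` paddings make room for the insertions. The other `u.length + k` ensure, by
    -- preservation of length, that the output has at least the `k` paddings of `z`.
    obtain ⟨x', hx'⟩ := exists_mem_substRel ρ (e := e) (k := n + u.length + k) hn (by omega)
    obtain ⟨k', rfl⟩ := substRel_eqEncode hx'
    refine ⟨_, (mem_encode_of_trimmed h he).2 ⟨_, rfl⟩, trimCells _,
      ⟨_, hx', rfl⟩, padDelRel_trimCells u ?_⟩
    have := length_eq_of_mem_substRel hx'
    simp only [List.length_append, List.length_replicate, ← hu] at this
    omega

end EquationEncodings

section SystemEncodings

variable {A : Type*} {V : Type*}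

/-! ### Words of letters as sequences of blocks -/

/-- The word that consists of the block `x` and the blocks `ys`, separated by delimiters. -/
def joinBlocks (x : List (Cell A V)) (ys : List (List (Cell A V))) : List (Letter A V) :=
  x.map Letter.cell ++ ys.flatMap fun y => Letter.delim :: y.map Letter.cell

theorem intercalate_eq_joinBlocks (x : List (Cell A V)) (ys : List (List (Cell A V))) :
    [Letter.delim].intercalate ((x :: ys).map (List.map Letter.cell)) = joinBlocks x ys := by
  induction ys generalizing x with
  | nil => simp [joinBlocks]
  | cons y ys ih =>
    have := ih y
    simp only [joinBlocks, List.map_cons, List.flatMap_cons] at this ⊢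
    rw [List.intercalate_cons_cons, this]
    simp

/-- The first block of a word, and its other blocks. -/
def splitBlocks : List (Letter A V) → List (Cell A V) × List (List (Cell A V))
  | [] => ([], [])
  | .delim :: w => ([], (splitBlocks w).1 :: (splitBlocks w).2)
  | .cell c :: w => (c :: (splitBlocks w).1, (splitBlocks w).2)

theorem splitBlocks_joinBlocks (x : List (Cell A V)) (ys : List (List (Cell A V))) :
    splitBlocks (joinBlocks x ys) = (x, ys) := by
  induction ys generalizing x with
  | nil =>
    induction x with
    | nil => rfl
    | cons c x ih =>
      rw [show joinBlocks (c :: x) [] = Letter.cell c :: joinBlocks x [] from rfl, splitBlocks, ih]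
  | cons y ys ih =>
    induction x with
    | nil =>
      rw [show joinBlocks [] (y :: ys) = Letter.delim :: joinBlocks y ys from rfl, splitBlocks, ih]
    | cons c x ihx =>
      rw [show joinBlocks (c :: x) (y :: ys) = Letter.cell c :: joinBlocks x (y :: ys) from rfl,
        splitBlocks, ihx]

theorem joinBlocks_inj {x x' : List (Cell A V)} {ys ys' : List (List (Cell A V))} :
    joinBlocks x ys = joinBlocks x' ys' ↔ x = x' ∧ ys = ys' := by
  constructor
  · intro h
    have := congrArg splitBlocks h
    rwa [splitBlocks_joinBlocks, splitBlocks_joinBlocks, Prod.mk.injEq] at this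
  · rintro ⟨rfl, rfl⟩
    rfl

/-- The system that a word of letters encodes. -/
def decodeSystem (w : List (Letter A V)) : System A V :=
  decode (splitBlocks w).1 :: (splitBlocks w).2.map decode

theorem joinBlocks_splitBlocks (w : List (Letter A V)) :
    joinBlocks (splitBlocks w).1 (splitBlocks w).2 = w := by
  induction w with
  | nil => rfl
  | cons c w ih =>
    cases c with
    | delim => exact congrArg (Letter.delim :: ·) ih
    | cell c => exact congrArg (Letter.cell c :: ·) ih

/-- Delimiters are never deleted, so deletion of paddings acts block by block. -/
theorem padDelRel_splitBlocks {w z : List (Letter A V)} (h : (w, z) ∈ padDelRel) :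
    ((splitBlocks w).1.map Letter.cell, (splitBlocks z).1.map Letter.cell) ∈ padDelRel ∧
      List.Forall₂ (fun x y => (x.map Letter.cell, y.map Letter.cell) ∈ padDelRel)
        (splitBlocks w).2 (splitBlocks z).2 := by
  refine padDelRel_induction (M := fun w z =>
    ((splitBlocks w).1.map Letter.cell, (splitBlocks z).1.map Letter.cell) ∈ padDelRel ∧
      List.Forall₂ (fun x y => (x.map Letter.cell, y.map Letter.cell) ∈ padDelRel)
        (splitBlocks w).2 (splitBlocks z).2) ⟨nil_mem_relStar _, .nil⟩ ?_ ?_ h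
  · rintro (c | _) w z ⟨h₁, h₂⟩
    · exact ⟨padDelRel_cons _ h₁, h₂⟩
    · exact ⟨nil_mem_relStar _, .cons h₁ h₂⟩
  · rintro w z ⟨h₁, h₂⟩
    exact ⟨padDelRel_pad h₁, h₂⟩

theorem pad_notMem_eqEncode (s t : Term A V) : (none, none) ∉ eqEncode s t := by
  induction s, t using eqEncode.induct <;> simp_all [eqEncode]

/-- All paddings stand at the end, so deleting some of them only changes their number. -/
theorem exists_eq_append_of_padDelRel {u : List (Cell A V)} (hu : (none, none) ∉ u) {k : ℕ}
    {z : List (Letter A V)}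
    (h : ((u ++ List.replicate k (none, none)).map Letter.cell, z) ∈ padDelRel) :
    ∃ k', z = (u ++ List.replicate k' (none, none)).map Letter.cell := by
  refine padDelRel_induction (M := fun w z => ∀ u k, (none, none) ∉ u →
    w = (u ++ List.replicate k (none, none)).map Letter.cell →
    ∃ k', z = (u ++ List.replicate k' (none, none)).map Letter.cell) ?_ ?_ ?_ h u k hu rfl
  · rintro (_ | ⟨c, u⟩) (_ | k) hu h
    · exact ⟨0, rfl⟩
    all_goals simp at h
  · rintro c w z ih (_ | ⟨a, u⟩) k hu h
    · cases k with
      | zero => simp at h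
      | succ k =>
        obtain ⟨rfl, rfl⟩ := List.cons_eq_cons.1 h
        obtain ⟨k', rfl⟩ := ih [] k (by simp) rfl
        exact ⟨k' + 1, rfl⟩
    · obtain ⟨rfl, rfl⟩ := List.cons_eq_cons.1 h
      obtain ⟨k', rfl⟩ := ih u k (fun h => hu (by simp [h])) rfl
      exact ⟨k', rfl⟩
  · rintro w z ih (_ | ⟨a, u⟩) k hu h
    · cases k with
      | zero => simp at h
      | succ k => exact ih [] k (by simp) (List.cons_eq_cons.1 h).2
    · have := Letter.cell.inj (List.cons_eq_cons.1 h).1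
      exact absurd (by simp [this]) hu

theorem padDelRel_append_append {w z w' z' : List (Letter A V)} (h : (w, z) ∈ padDelRel)
    (h' : (w', z') ∈ padDelRel) : (w ++ w', z ++ z') ∈ padDelRel :=
  padDelRel_induction (M := fun w z => (w ++ w', z ++ z') ∈ padDelRel) h'
    (fun c _ _ ih => padDelRel_cons c ih) (fun _ _ ih => padDelRel_pad ih) h

theorem mem_relStar_delim {R : Set (List (Cell A V) × List (Cell A V))}
    {w w' : List (Letter A V)} :
    (w, w') ∈ relStar (relConcat {([Letter.delim], [Letter.delim])} (liftRel R)) ↔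
      ∃ ys ys', List.Forall₂ (fun y y' => (y, y') ∈ R) ys ys' ∧
        w = (ys.flatMap fun y => Letter.delim :: y.map Letter.cell) ∧
        w' = ys'.flatMap fun y => Letter.delim :: y.map Letter.cell := by
  constructor
  · refine relStar_induction (M := fun w w' => ∃ ys ys',
      List.Forall₂ (fun y y' => (y, y') ∈ R) ys ys' ∧
        w = (ys.flatMap fun y => Letter.delim :: y.map Letter.cell) ∧
        w' = ys'.flatMap fun y => Letter.delim :: y.map Letter.cell) ⟨[], [], .nil, rfl, rfl⟩ ?_
    rintro u₁ v₁ _ _ h ⟨ys, ys', hys, rfl, rfl⟩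
    obtain ⟨_, _, _, _, h₁, ⟨⟨y, y'⟩, hy, h₂⟩, rfl, rfl⟩ := mem_relConcat.1 h
    obtain ⟨rfl, rfl⟩ := Prod.mk.inj h₁
    obtain ⟨rfl, rfl⟩ := Prod.mk.inj h₂
    exact ⟨y :: ys, y' :: ys', .cons hy hys, rfl, rfl⟩
  · rintro ⟨ys, ys', h, rfl, rfl⟩
    induction h with
    | nil => exact nil_mem_relStar _
    | cons h _ ih =>
      refine append_mem_relStar (append_mem_relConcat (R₂ := liftRel R) (u₁ := [Letter.delim])
        (v₁ := [Letter.delim]) rfl ⟨_, h, rfl⟩) ih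

theorem mem_passRel {p p' : List (Letter A V)} :
    (p, p') ∈ passRel ↔ p' = p ∧ ∀ c ∈ p, c = padLetter ∨ c = Letter.delim := by
  constructor
  · refine relStar_induction
      (M := fun p p' => p' = p ∧ ∀ c ∈ p, c = padLetter ∨ c = Letter.delim) ⟨rfl, by simp⟩ ?_
    rintro u₁ v₁ u₂ v₂ (h | h) ⟨rfl, hu⟩ <;>
    · obtain ⟨rfl, rfl⟩ := Prod.mk.inj h
      exact ⟨rfl, by simpa using hu⟩
  · rintro ⟨rfl, h⟩
    induction p' with
    | nil => exact nil_mem_relStar _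
    | cons c p ih =>
      refine append_mem_relStar (u₁ := [c]) (v₁ := [c]) ?_ (ih fun c hc => h c (by simp [hc]))
      rcases h c (by simp) with rfl | rfl
      · exact .inl rfl
      · exact .inr rfl

variable [DecidableEq A] [DecidableEq V]

theorem mem_encodeSystem_cons {e : Equation A V} {Φ : System A V} {w : List (Letter A V)} :
    w ∈ encodeSystem (e :: Φ) ↔ ∃ x ∈ encode e, ∃ ys,
      List.Forall₂ (fun d y => y ∈ encode d) Φ ys ∧ w = joinBlocks x ys := by
  constructor
  · rintro ⟨_, _ | ⟨hx, hys⟩, rfl⟩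
    exact ⟨_, hx, _, hys, intercalate_eq_joinBlocks _ _⟩
  · rintro ⟨x, hx, ys, hys, rfl⟩
    exact ⟨x :: ys, .cons hx hys, (intercalate_eq_joinBlocks _ _).symm⟩

/-- A word determines the trimmed system that it encodes, with one ambiguity: the empty word encodes
both `[]` and a single empty equation, and is decoded as the latter. -/
theorem decodeSystem_of_mem {Φ : System A V} (hΦ : Φ ≠ []) {w : List (Letter A V)}
    (hw : w ∈ encodeSystem Φ) : decodeSystem w = Φ.map fun e => trimEq e.1 e.2 := by
  cases Φ with
  | nil => exact absurd rfl hΦ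
  | cons e Φ =>
    obtain ⟨x, hx, ys, hys, rfl⟩ := mem_encodeSystem_cons.1 hw
    rw [decodeSystem, splitBlocks_joinBlocks, List.map_cons, decode_of_mem_encode hx]
    congr 1
    clear hw
    induction hys with
    | nil => rfl
    | cons h _ ih => rw [List.map_cons, List.map_cons, decode_of_mem_encode h, ih (by simp)]

theorem mem_ruleSeqRel {ρ : Rule A V} {n : ℕ} {w w' : List (Letter A V)} :
    (w, w') ∈ ruleSeqRel ρ n ↔ ∃ p x x' ys ys',
      (∀ c ∈ p, c = padLetter ∨ c = Letter.delim) ∧ (x, x') ∈ ruleRel ρ n ∧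
      List.Forall₂ (fun y y' => (y, y') ∈ relComp trimRel (substRel ρ n)) ys ys' ∧
      w = p ++ joinBlocks x ys ∧ w' = p ++ joinBlocks x' ys' := by
  rw [ruleSeqRel, mem_relConcat]
  constructor
  · rintro ⟨p, p', _, _, hp, h, rfl, rfl⟩
    obtain ⟨rfl, hp⟩ := mem_passRel.1 hp
    obtain ⟨_, _, _, _, ⟨⟨x, x'⟩, hx, h₂⟩, h', rfl, rfl⟩ := mem_relConcat.1 h
    obtain ⟨rfl, rfl⟩ := Prod.mk.inj h₂
    obtain ⟨ys, ys', hys, rfl, rfl⟩ := mem_relStar_delim.1 h'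
    exact ⟨p', x, x', ys, ys', hp, hx, hys, rfl, rfl⟩
  · rintro ⟨p, x, x', ys, ys', hp, hx, hys, rfl, rfl⟩
    exact ⟨p, p, _, _, mem_passRel.2 ⟨rfl, hp⟩, append_mem_relConcat ⟨_, hx, rfl⟩
      (mem_relStar_delim.2 ⟨ys, ys', hys, rfl, rfl⟩), rfl, rfl⟩

theorem mem_ruleRel {ρ : Rule A V} {n : ℕ} {x x' : List (Cell A V)} :
    (x, x') ∈ ruleRel ρ n ↔ ρ.Guard some (x.head?.map Prod.fst) (x.head?.map Prod.snd) ∧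
      (x, x') ∈ relComp trimRel (substRel ρ n) := by
  constructor
  · rintro ⟨y, ⟨hg, hy⟩, h⟩
    exact ⟨hg, y, hy, h⟩
  · rintro ⟨hg, y, hy, h⟩
    exact ⟨y, ⟨hg, hy⟩, h⟩

/-! ### Nielsen steps on systems and on their encodings -/

/-- The substitution of a rule in an equation, followed by trimming. -/
def Rule.step (ρ : Rule A V) (e : Equation A V) : Equation A V :=
  trimEq (ρ.substEq e).1 (ρ.substEq e).2

theorem Rule.applies_cons_of_guard {ρ : Rule A V} {e : Equation A V} (Φ : System A V)
    (h : ρ.Guard id e.1.head? e.2.head?) : ρ.Applies (e :: Φ) ((e :: Φ).map ρ.step) :=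
  ⟨[], e, Φ, rfl, by simp, h, rfl⟩

theorem Rule.Applies.cons_nil {ρ : Rule A V} {Φ Φ' : System A V} (h : ρ.Applies Φ Φ') :
    ρ.Applies (([], []) :: Φ) (([], []) :: Φ') := by
  obtain ⟨Φ₁, e, Φ₂, rfl, h₁, h₂, rfl⟩ := h
  exact ⟨([], []) :: Φ₁, e, Φ₂, rfl, by simpa using h₁, h₂, rfl⟩

/-- Induction on the number of leading empty equations. In an encoding each of them contributes one
delimiter, which the rule relation passes over. -/
theorem Rule.applies_induction {ρ : Rule A V} {M : System A V → System A V → Prop}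
    (guard : ∀ e Φ, ρ.Guard id e.1.head? e.2.head? → M (e :: Φ) ((e :: Φ).map ρ.step))
    (cons : ∀ Φ Φ', ρ.Applies Φ Φ' → M Φ Φ' → M (([], []) :: Φ) (([], []) :: Φ'))
    {Φ Φ' : System A V} (h : ρ.Applies Φ Φ') : M Φ Φ' := by
  obtain ⟨Φ₁, e, Φ₂, rfl, h₁, h₂, rfl⟩ := h
  induction Φ₁ with
  | nil => exact guard e Φ₂ h₂
  | cons d Φ₁ ih =>
    obtain rfl := h₁ d (by simp)
    have h₁' : ∀ d ∈ Φ₁, d = ([], []) := fun d hd => h₁ d (by simp [hd])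
    exact cons _ _ ⟨Φ₁, e, Φ₂, rfl, h₁', h₂, rfl⟩ (ih h₁')

theorem Rule.Applies.length_eq {ρ : Rule A V} {Φ Φ' : System A V} (h : ρ.Applies Φ Φ') :
    Φ'.length = Φ.length := by
  obtain ⟨Φ₁, e, Φ₂, rfl, h₁, h₂, rfl⟩ := h
  simp

theorem Rule.Applies.ne_nil {ρ : Rule A V} {Φ Φ' : System A V} (h : ρ.Applies Φ Φ') :
    Φ ≠ [] ∧ Φ' ≠ [] := by
  have := h.length_eq
  obtain ⟨Φ₁, e, Φ₂, rfl, h₁, h₂, rfl⟩ := h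
  simp

theorem Rule.Applies.isTrimmed {ρ : Rule A V} {Φ Φ' : System A V} (h : ρ.Applies Φ Φ') :
    IsTrimmed Φ' := by
  refine Rule.applies_induction (M := fun _ Φ' => IsTrimmed Φ') ?_ ?_ h
  · intro e Φ _ d hd
    obtain ⟨d, -, rfl⟩ := List.mem_map.1 hd
    exact trimEq_trimEq _ _
  · intro Φ Φ' _ ih d hd
    rcases List.mem_cons.1 hd with rfl | hd
    · exact trimEq.eq_2 _ _ (by simp)
    · exact ih d hd

theorem mem_encodeSystem_nil_cons {Φ : System A V} (hΦ : Φ ≠ []) {w : List (Letter A V)} :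
    w ∈ encodeSystem (([], []) :: Φ) ↔ ∃ w' ∈ encodeSystem Φ, w = .delim :: w' := by
  cases Φ with
  | nil => exact absurd rfl hΦ
  | cons e Φ =>
    rw [mem_encodeSystem_cons_cons]
    simp [mem_encode_nil]

/-- On the encodings of a trimmed system, the relation of a rule performs the Nielsen step. -/
theorem exists_applies_of_mem_ruleSeqRel {ρ : Rule A V} {n : ℕ} {Φ : System A V}
    (hΦ : IsTrimmed Φ) {w w' : List (Letter A V)} (hw : w ∈ encodeSystem Φ)
    (h : (w, w') ∈ ruleSeqRel ρ n) : ∃ Φ', ρ.Applies Φ Φ' ∧ w' ∈ encodeSystem Φ' := by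
  obtain ⟨p, x, x', ys, ys', hp, hx, hys, rfl, rfl⟩ := mem_ruleSeqRel.1 h
  clear h
  obtain ⟨hg, hx⟩ := mem_ruleRel.1 hx
  have hx0 : x ≠ [] := by
    rintro rfl
    exact ρ.not_guard_none _ hg
  induction p generalizing Φ with
  | nil =>
    cases Φ with
    | nil =>
      refine absurd (mem_encodeSystem_nil.1 hw) ?_
      simp [joinBlocks, hx0]
    | cons e Φ =>
      obtain ⟨x₀, hx₀, ys₀, hys₀, h⟩ := mem_encodeSystem_cons.1 hw
      obtain ⟨rfl, rfl⟩ := joinBlocks_inj.1 (by simpa using h)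
      have he := hΦ e (by simp)
      refine ⟨_, ρ.applies_cons_of_guard Φ ((guard_iff_of_mem_encode ρ he hx₀).1 hg), ?_⟩
      rw [List.map_cons, List.nil_append, mem_encodeSystem_cons]
      refine ⟨x', ?_, ys', ?_, rfl⟩
      · rw [Rule.step, encode_trimEq]
        exact mem_encode_substEq he hx₀ hx
      · have hΦ' : ∀ d ∈ Φ, trimEq d.1 d.2 = d := fun d hd => hΦ d (by simp [hd])
        clear hw h hΦ
        induction hys₀ generalizing ys' with
        | nil => cases hys; exact .nil
        | cons hd _ ih =>
          obtain _ | ⟨hy, hys⟩ := hys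
          refine .cons ?_ (ih _ hys fun d hd => hΦ' d (by simp [hd]))
          rw [Rule.step, encode_trimEq]
          exact mem_encode_substEq (hΦ' _ (by simp)) hd hy
  | cons c p ih =>
    have hp' : ∀ c ∈ p, c = padLetter ∨ c = Letter.delim := fun c hc => hp c (by simp [hc])
    cases Φ with
    | nil => exact absurd (mem_encodeSystem_nil.1 hw) (by simp)
    | cons e Φ =>
      obtain ⟨x₀, hx₀, ys₀, hys₀, h⟩ := mem_encodeSystem_cons.1 hw
      rcases hp c (by simp) with rfl | rfl
      -- A passed padding is impossible at the beginning of an encoding. A passed delimiter, treated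
      -- below, closes the block of an empty equation.
      · cases x₀ with
        | nil => cases ys₀ <;> simp [joinBlocks] at h
        | cons c x₀ =>
          obtain rfl : (none, none) = c := by
            have := List.head_eq_of_cons_eq h
            exact Letter.cell.inj this
          exact absurd hx₀ pad_cons_notMem_encode
      · have he := hΦ e (by simp)
        cases x₀ with
        | cons c x₀ => simp [joinBlocks] at h
        | nil =>
          obtain rfl := eq_nil_of_nil_mem_encode he hx₀
          cases hys₀ with
          | nil => simp [joinBlocks] at h
          | @cons e' y Φ ys₀ hy hys₀ =>
            have h' : p ++ joinBlocks x ys = joinBlocks y ys₀ := List.tail_eq_of_cons_eq h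
            obtain ⟨Φ', hΦ', hw'⟩ := ih (Φ := e' :: Φ) (fun d hd => hΦ d (by simp_all))
              hp' (mem_encodeSystem_cons.2 ⟨y, hy, ys₀, hys₀, h'⟩)
            exact ⟨_, hΦ'.cons_nil, (mem_encodeSystem_nil_cons hΦ'.ne_nil.2).2 ⟨_, hw', rfl⟩⟩

/-- Up to deletion of paddings, all encodings of the result of a Nielsen step are obtained. -/
theorem exists_mem_ruleSeqRel_of_applies {ρ : Rule A V} {n : ℕ} {Φ Φ' : System A V}
    (hΦ : IsTrimmed Φ) (hn : ∀ e ∈ Φ, (e.1 ++ e.2).count (.inr ρ.var) ≤ n)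
    (h : ρ.Applies Φ Φ') {z : List (Letter A V)} (hz : z ∈ encodeSystem Φ') :
    ∃ w ∈ encodeSystem Φ, ∃ w', (w, w') ∈ ruleSeqRel ρ n ∧ (w', z) ∈ padDelRel := by
  refine Rule.applies_induction (M := fun Φ Φ' => IsTrimmed Φ →
    (∀ e ∈ Φ, (e.1 ++ e.2).count (.inr ρ.var) ≤ n) → ∀ z ∈ encodeSystem Φ',
    ∃ w ∈ encodeSystem Φ, ∃ w', (w, w') ∈ ruleSeqRel ρ n ∧ (w', z) ∈ padDelRel)
    ?_ ?_ h hΦ hn z hz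
  · intro e Φ hg hΦ hn z hz
    obtain ⟨z₀, hz₀, zs, hzs, rfl⟩ := mem_encodeSystem_cons.1 hz
    rw [Rule.step, encode_trimEq] at hz₀
    have he := hΦ e (by simp)
    obtain ⟨x, hx, x', hxx', hxz⟩ := exists_mem_encode_substEq he (hn e (by simp)) hz₀
    have key : ∃ ys, List.Forall₂ (fun d y => y ∈ encode d) Φ ys ∧ ∃ ys',
        List.Forall₂ (fun y y' => (y, y') ∈ relComp trimRel (substRel ρ n)) ys ys' ∧
        (ys'.flatMap (fun y => Letter.delim :: y.map Letter.cell),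
          zs.flatMap fun y => Letter.delim :: y.map Letter.cell) ∈ padDelRel := by
      have hΦ' : ∀ d ∈ Φ, trimEq d.1 d.2 = d := fun d hd => hΦ d (by simp [hd])
      have hn' : ∀ d ∈ Φ, (d.1 ++ d.2).count (.inr ρ.var) ≤ n := fun d hd => hn d (by simp [hd])
      clear hz hΦ hn
      induction Φ generalizing zs with
      | nil =>
        cases hzs
        exact ⟨[], .nil, [], .nil, nil_mem_relStar _⟩
      | cons d Φ ih =>
        obtain _ | ⟨hd, hzs⟩ := hzs
        rw [Rule.step, encode_trimEq] at hd
        obtain ⟨ys, hys, ys', hyy', hdel⟩ := ih _ hzs (fun d hd => hΦ' d (by simp [hd]))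
          (fun d hd => hn' d (by simp [hd]))
        obtain ⟨y, hy, y', hyy, hyz⟩ :=
          exists_mem_encode_substEq (hΦ' d (by simp)) (hn' d (by simp)) hd
        exact ⟨y :: ys, .cons hy hys, y' :: ys', .cons hyy hyy',
          padDelRel_append_append (padDelRel_cons _ hyz) hdel⟩
    obtain ⟨ys, hys, ys', hyy', hdel⟩ := key
    refine ⟨_, mem_encodeSystem_cons.2 ⟨x, hx, ys, hys, rfl⟩, joinBlocks x' ys', ?_,
      padDelRel_append_append hxz hdel⟩
    exact mem_ruleSeqRel.2 ⟨[], x, x', ys, ys', by simp,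
      mem_ruleRel.2 ⟨(guard_iff_of_mem_encode ρ he hx).2 hg, hxx'⟩, hyy', rfl, rfl⟩
  · intro Φ Φ' hap ih hΦ hn z hz
    obtain ⟨z, hz', rfl⟩ := (mem_encodeSystem_nil_cons hap.ne_nil.2).1 hz
    obtain ⟨w, hw, w', hww', hdel⟩ := ih (fun d hd => hΦ d (by simp [hd]))
      (fun d hd => hn d (by simp [hd])) z hz'
    refine ⟨_, (mem_encodeSystem_nil_cons hap.ne_nil.1).2 ⟨w, hw, rfl⟩, .delim :: w', ?_,
      padDelRel_cons _ hdel⟩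
    obtain ⟨p, x, x', ys, ys', hp, hx, hys, rfl, rfl⟩ := mem_ruleSeqRel.1 hww'
    exact mem_ruleSeqRel.2 ⟨.delim :: p, x, x', ys, ys', by simpa using hp, hx, hys, rfl, rfl⟩

theorem mem_encode_of_padDelRel {e : Equation A V} {x z : List (Cell A V)} (hx : x ∈ encode e)
    (h : (x.map Letter.cell, z.map Letter.cell) ∈ padDelRel) : z ∈ encode e := by
  rw [← encode_trimEq] at hx ⊢
  have he := trimEq_trimEq e.1 e.2
  generalize trimEq e.1 e.2 = e at *
  by_cases he' : e = ([], [])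
  · subst he'
    obtain rfl := mem_encode_nil.1 hx
    have : z.map Letter.cell = [] := padDelRel_induction (M := fun w z => w = [] → z = [])
      (fun _ => rfl) (by simp) (by simp) h rfl
    exact mem_encode_nil.2 (List.map_eq_nil_iff.1 this)
  · rw [mem_encode_of_trimmed he he'] at hx ⊢
    obtain ⟨k, rfl⟩ := hx
    exact (exists_eq_append_of_padDelRel (pad_notMem_eqEncode _ _) h).imp fun _ h =>
      List.map_injective_iff.2 (fun _ _ => Letter.cell.inj) h

/-- Encodings are closed under deletion of paddings. -/
theorem mem_encodeSystem_of_padDelRel {Φ : System A V} {w z : List (Letter A V)}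
    (hw : w ∈ encodeSystem Φ) (h : (w, z) ∈ padDelRel) : z ∈ encodeSystem Φ := by
  obtain ⟨h₁, h₂⟩ := padDelRel_splitBlocks h
  cases Φ with
  | nil =>
    obtain rfl := mem_encodeSystem_nil.1 hw
    refine mem_encodeSystem_nil.2 ?_
    exact padDelRel_induction (M := fun w z => w = [] → z = []) (fun _ => rfl) (by simp) (by simp)
      h rfl
  | cons e Φ =>
    obtain ⟨x, hx, ys, hys, rfl⟩ := mem_encodeSystem_cons.1 hw
    rw [splitBlocks_joinBlocks] at h₁ h₂
    refine mem_encodeSystem_cons.2 ⟨_, mem_encode_of_padDelRel hx h₁, (splitBlocks z).2, ?_,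
      (joinBlocks_splitBlocks z).symm⟩
    generalize (splitBlocks z).2 = zs at h₂
    clear h₁ h hw hx
    induction hys generalizing zs with
    | nil => cases h₂; exact .nil
    | cons hd _ ih =>
      obtain _ | ⟨h, h₂⟩ := h₂
      exact .cons (mem_encode_of_padDelRel hd h) (ih _ h₂)

end SystemEncodings

section Nielsen

variable {A : Type*} {V : Type*}

/-! ### Models under Nielsen steps -/

@[simp]
theorem Assignment.eval_nil (I : Assignment A V) : I.eval [] = [] := rfl

theorem Assignment.eval_cons (I : Assignment A V) (c : A ⊕ V) (t : Term A V) :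
    I.eval (c :: t) = I.eval [c] ++ I.eval t := by
  simp [Assignment.eval]

@[simp]
theorem Assignment.eval_inl (I : Assignment A V) (a : A) : I.eval [Sum.inl a] = [a] := rfl

@[simp]
theorem Assignment.eval_inr (I : Assignment A V) (x : V) : I.eval [Sum.inr x] = I x := by
  simp [Assignment.eval]

/-- The variable `x` occurs in the system `Φ`. -/
def Occurs (x : V) (Φ : System A V) : Prop :=
  ∃ e ∈ Φ, Sum.inr x ∈ e.1 ∨ Sum.inr x ∈ e.2

theorem Rule.Guard.var_mem {ρ : Rule A V} {e : Equation A V}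
    (h : ρ.Guard id e.1.head? e.2.head?) : Sum.inr ρ.var ∈ e.1 ∨ Sum.inr ρ.var ∈ e.2 := by
  cases ρ with
  | prepend y α =>
    rcases h with h | h
    · exact .inl (List.mem_of_mem_head? h.1)
    · exact .inr (List.mem_of_mem_head? h.2)
  | erase y =>
    rcases h with h | h
    · exact .inl (List.mem_of_mem_head? h)
    · exact .inr (List.mem_of_mem_head? h)

theorem Rule.Guard.replacement_subset {ρ : Rule A V} {e : Equation A V}
    (h : ρ.Guard id e.1.head? e.2.head?) {c : A ⊕ V} (hc : c ∈ ρ.replacement) :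
    c ∈ e.1 ∨ c ∈ e.2 := by
  have hv := h.var_mem
  cases ρ with
  | prepend y α =>
    have : c = α ∨ c = Sum.inr y := by simpa [Rule.replacement] using hc
    rcases this with rfl | rfl
    · rcases h with h | h
      · exact .inr (List.mem_of_mem_head? h.2)
      · exact .inl (List.mem_of_mem_head? h.1)
    · exact hv
  | erase y => simp [Rule.replacement] at hc

/-- The total weight of the two sides of an equation. -/
def eqWeight (f : A ⊕ V → ℕ) (e : Equation A V) : ℕ :=
  (e.1.map f).sum + (e.2.map f).sum

/-- The total weight of a system. -/
def weight (f : A ⊕ V → ℕ) (Φ : System A V) : ℕ :=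
  (Φ.map (eqWeight f)).sum

theorem weight_cons (f : A ⊕ V → ℕ) (e : Equation A V) (Φ : System A V) :
    weight f (e :: Φ) = eqWeight f e + weight f Φ := rfl

/-- Fixing the number of equations is necessary because empty equations have weight zero. -/
theorem finite_setOf_weight_le [Finite A] [Finite V] (n N : ℕ) :
    {Φ : System A V | Φ.length = n ∧ weight (fun _ => 1) Φ ≤ N}.Finite := by
  let S : Set (Equation A V) := {t | t.length ≤ N} ×ˢ {t | t.length ≤ N}
  have hS : S.Finite := (List.finite_length_le _ N).prod (List.finite_length_le _ N)
  have := hS.to_subtype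
  refine ((List.finite_length_eq S n).image (List.map Subtype.val)).subset ?_
  rintro Φ ⟨hn, hN⟩
  have hmem : ∀ e ∈ Φ, e ∈ S := by
    intro e he
    have := List.le_sum_of_mem (List.mem_map_of_mem (f := eqWeight fun _ => 1) he)
    have := this.trans hN
    simp only [eqWeight, List.map_const', List.sum_replicate, smul_eq_mul, mul_one] at this
    exact ⟨show e.1.length ≤ N by omega, show e.2.length ≤ N by omega⟩
  lift Φ to List S using hmem
  exact ⟨Φ, by simpa using hn, rfl⟩

variable [DecidableEq A] [DecidableEq V]

theorem eval_substTerm {I J : Assignment A V} {x : V} {s : Term A V} (h : J x = I.eval s)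
    (h' : ∀ y ≠ x, J y = I y) (t : Term A V) : I.eval (substTerm x s t) = J.eval t := by
  induction t with
  | nil => rfl
  | cons c t ih =>
    have hc : I.eval (if c = Sum.inr x then s else [c]) = J.eval [c] := by
      rcases c with a | y
      · simp
      · by_cases hy : y = x
        · simp [hy, h]
        · simp [hy, h' y hy]
    rw [J.eval_cons, ← ih, ← hc, substTerm, List.flatMap_cons, Assignment.eval,
      List.flatMap_append]
    rfl

theorem eval_trimEq (I : Assignment A V) (s t : Term A V) :
    I.eval (trimEq s t).1 = I.eval (trimEq s t).2 ↔ I.eval s = I.eval t := by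
  induction s, t using trimEq.induct with
  | case1 s a t ih => rw [trimEq, if_pos rfl, ih, I.eval_cons a s, I.eval_cons a t,
      List.append_cancel_left_eq]
  | case2 a s b t h => rw [trimEq, if_neg h]
  | case3 s t h => rw [trimEq.eq_2 _ _ h]

theorem isModel_map_trimEq (I : Assignment A V) (Φ : System A V) :
    IsModel I (Φ.map fun e => trimEq e.1 e.2) ↔ IsModel I Φ := by
  unfold IsModel
  rw [List.forall_mem_map]
  exact forall₂_congr fun e _ => eval_trimEq I _ _

theorem Rule.Applies.isModel_iff {ρ : Rule A V} {Φ Φ' : System A V} (h : ρ.Applies Φ Φ')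
    {I J : Assignment A V} (hJ : J ρ.var = I.eval ρ.replacement) (hJ' : ∀ y ≠ ρ.var, J y = I y) :
    IsModel I Φ' ↔ IsModel J Φ := by
  refine Rule.applies_induction (M := fun Φ Φ' => IsModel I Φ' ↔ IsModel J Φ) ?_ ?_ h
  · intro e Φ _
    have : ∀ d : Equation A V, I.eval (ρ.step d).1 = I.eval (ρ.step d).2 ↔
        J.eval d.1 = J.eval d.2 := by
      intro d
      rw [Rule.step, eval_trimEq, Rule.substEq, eval_substTerm hJ hJ', eval_substTerm hJ hJ']
    unfold IsModel
    rw [List.forall_mem_map]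
    exact forall₂_congr fun d _ => this d
  · intro Φ Φ' _ ih
    unfold IsModel at ih ⊢
    simpa [-Prod.forall] using ih

theorem trimEq_suffix (s t : Term A V) : (trimEq s t).1 <:+ s ∧ (trimEq s t).2 <:+ t := by
  induction s, t using trimEq.induct with
  | case1 s a t ih =>
    rw [trimEq, if_pos rfl]
    exact ⟨ih.1.trans (List.suffix_cons _ _), ih.2.trans (List.suffix_cons _ _)⟩
  | case2 a s b t h => rw [trimEq, if_neg h]; simp
  | case3 s t h => rw [trimEq.eq_2 _ _ h]; simp

theorem substTerm_cons_self (x : V) (s t : Term A V) :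
    substTerm x s (Sum.inr x :: t) = s ++ substTerm x s t := by
  simp [substTerm]

theorem substTerm_cons_of_ne {x : V} {c : A ⊕ V} (h : c ≠ Sum.inr x) (s t : Term A V) :
    substTerm x s (c :: t) = c :: substTerm x s t := by
  simp [substTerm, h]

theorem mem_substTerm {x : V} {s t : Term A V} {c : A ⊕ V} (h : c ∈ substTerm x s t) :
    c ∈ s ∧ Sum.inr x ∈ t ∨ c ∈ t ∧ c ≠ Sum.inr x := by
  obtain ⟨d, hd, hc⟩ := List.mem_flatMap.1 h
  split_ifs at hc with hx
  · exact .inl ⟨hc, hx ▸ hd⟩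
  · obtain rfl := List.mem_singleton.1 hc
    exact .inr ⟨hd, hx⟩

theorem Rule.mem_step {ρ : Rule A V} {d : Equation A V} {c : A ⊕ V}
    (h : c ∈ (ρ.step d).1 ∨ c ∈ (ρ.step d).2) :
    c ∈ ρ.replacement ∨ (c ∈ d.1 ∨ c ∈ d.2) ∧ c ≠ Sum.inr ρ.var := by
  obtain ⟨h₁, h₂⟩ := trimEq_suffix (ρ.substEq d).1 (ρ.substEq d).2
  rcases h with h | h
  · rcases mem_substTerm (h₁.subset h) with h | h
    · exact .inl h.1
    · exact .inr ⟨.inl h.1, h.2⟩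
  · rcases mem_substTerm (h₂.subset h) with h | h
    · exact .inl h.1
    · exact .inr ⟨.inr h.1, h.2⟩

theorem Rule.Applies.occurs_var {ρ : Rule A V} {Φ Φ' : System A V} (h : ρ.Applies Φ Φ') :
    Occurs ρ.var Φ := by
  obtain ⟨Φ₁, e, Φ₂, rfl, h₁, h₂, rfl⟩ := h
  exact ⟨e, by simp, h₂.var_mem⟩

theorem Rule.Applies.occurs {ρ : Rule A V} {Φ Φ' : System A V} (h : ρ.Applies Φ Φ') {x : V}
    (hx : Occurs x Φ') : Sum.inr x ∈ ρ.replacement ∨ Occurs x Φ ∧ x ≠ ρ.var := by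
  obtain ⟨Φ₁, e, Φ₂, rfl, h₁, h₂, rfl⟩ := h
  obtain ⟨d, hd, hx⟩ := hx
  rcases List.mem_append.1 hd with hd | hd
  · obtain rfl := h₁ d hd
    simp at hx
  · obtain ⟨d, hd, rfl⟩ := List.mem_map.1 hd
    rcases Rule.mem_step hx with h | ⟨h, h'⟩
    · exact .inl h
    · exact .inr ⟨⟨d, by simp_all, h⟩, fun h => h' (h ▸ rfl)⟩

theorem Rule.Applies.occurs_of_mem_replacement {ρ : Rule A V} {Φ Φ' : System A V}
    (h : ρ.Applies Φ Φ') {x : V} (hx : Sum.inr x ∈ ρ.replacement) : Occurs x Φ := by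
  obtain ⟨Φ₁, e, Φ₂, rfl, h₁, h₂, rfl⟩ := h
  exact ⟨e, by simp, h₂.replacement_subset hx⟩

/-- Undoing a rule turns a model of the new system into a model of the old one, provided that
variables that do not occur are mapped to the empty word. -/
theorem Rule.Applies.undo {ρ : Rule A V} {Φ Φ' : System A V} (h : ρ.Applies Φ Φ')
    {I : Assignment A V} (hI : IsModel I Φ') (hI' : ∀ x, ¬ Occurs x Φ' → I x = []) :
    IsModel (ρ.undo I) Φ ∧ ∀ x, ¬ Occurs x Φ → ρ.undo I x = [] := by
  have hocc : ∀ x, ¬ Occurs x Φ → I x = [] := by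
    refine fun x hx => hI' x fun hx' => hx ?_
    rcases h.occurs hx' with h' | h'
    · exact h.occurs_of_mem_replacement h'
    · exact h'.1
  cases ρ with
  | prepend y α =>
    refine ⟨(h.isModel_iff (I := I) ?_ ?_).1 hI, fun x hx => ?_⟩
    · rw [Rule.replacement, I.eval_cons]
      simp [Rule.undo, Rule.var]
    · intro x hx
      exact Function.update_of_ne hx _ _
    · have hxy : x ≠ y := by
        rintro rfl
        exact hx h.occurs_var
      exact (Function.update_of_ne hxy _ _).trans (hocc x hx)
  | erase y =>
    refine ⟨(h.isModel_iff (I := I) ?_ fun _ _ => rfl).1 hI, hocc⟩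
    -- After its erasure `y` no longer occurs, so the second hypothesis gives `I y = []`, the value
    -- that `y ↪ ε` requires.
    refine hI' y fun hy => ?_
    rcases h.occurs hy with h' | h'
    · simp [Rule.replacement] at h'
    · exact h'.2 rfl

/-! ### Weights of systems -/

theorem eqWeight_trimEq_le (f : A ⊕ V → ℕ) (e : Equation A V) :
    eqWeight f (trimEq e.1 e.2) ≤ eqWeight f e := by
  obtain ⟨h₁, h₂⟩ := trimEq_suffix e.1 e.2
  exact add_le_add ((h₁.sublist.map f).sum_le_sum (by simp))
    ((h₂.sublist.map f).sum_le_sum (by simp))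

/-- Each occurrence of `x` trades its weight for that of `s`; written with sums on both sides to
avoid truncated subtraction. -/
theorem sum_map_substTerm (f : A ⊕ V → ℕ) (x : V) (s t : Term A V) :
    ((substTerm x s t).map f).sum + t.count (.inr x) * f (.inr x) =
      (t.map f).sum + t.count (.inr x) * (s.map f).sum := by
  induction t with
  | nil => simp [substTerm]
  | cons c t ih =>
    rw [substTerm, List.flatMap_cons, ← substTerm, List.map_append, List.sum_append, List.map_cons,
      List.sum_cons, List.count_cons]
    by_cases hc : c = Sum.inr x
    · simp only [hc, if_true, beq_self_eq_true]
      linarith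
    · simp only [hc, if_false, beq_iff_eq]
      simp only [List.map_cons, List.map_nil, List.sum_cons, List.sum_nil]
      linarith

theorem eqWeight_substEq_erase (f : A ⊕ V → ℕ) (y : V) (d : Equation A V) :
    eqWeight f ((Rule.erase y : Rule A V).substEq d) +
      (d.1 ++ d.2).count (.inr y) * f (.inr y) = eqWeight f d := by
  have h₁ := sum_map_substTerm f y [] d.1
  have h₂ := sum_map_substTerm f y [] d.2
  simp only [eqWeight, Rule.substEq, Rule.var, Rule.replacement, List.count_append] at *
  simp only [List.map_nil, List.sum_nil] at h₁ h₂
  linarith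

theorem eqWeight_substEq_prepend (f : A ⊕ V → ℕ) (y : V) (α : A ⊕ V) (d : Equation A V) :
    eqWeight f ((Rule.prepend y α).substEq d) =
      eqWeight f d + (d.1 ++ d.2).count (.inr y) * f α := by
  have h₁ := sum_map_substTerm f y [α, .inr y] d.1
  have h₂ := sum_map_substTerm f y [α, .inr y] d.2
  simp only [eqWeight, Rule.substEq, Rule.var, Rule.replacement, List.count_append] at *
  simp only [List.map_cons, List.map_nil, List.sum_cons, List.sum_nil] at h₁ h₂
  linarith

/-- The first symbols are `y` and `α`, and they differ because `e` is trimmed. The leading `α` is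
thus not replaced, both sides start with `α` after the substitution, and trimming removes these two
symbols. -/
theorem eqWeight_step_prepend_le (f : A ⊕ V → ℕ) {y : V} {α : A ⊕ V} {e : Equation A V}
    (he : trimEq e.1 e.2 = e) (h : (Rule.prepend y α).Guard id e.1.head? e.2.head?) :
    eqWeight f ((Rule.prepend y α).step e) + 2 * f α ≤
      eqWeight f ((Rule.prepend y α).substEq e) := by
  have hne : e ≠ ([], []) := by
    rintro rfl
    simp [Rule.Guard] at h
  have hα := head?_ne_of_trimmed he hne
  rw [Rule.step]
  obtain ⟨_ | ⟨a, s⟩, _ | ⟨b, t⟩⟩ := e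
  · simp [Rule.Guard] at h
  · simp [Rule.Guard] at h
  · simp [Rule.Guard] at h
  · have key : ∃ s' t', (Rule.prepend y α).substEq (a :: s, b :: t) = (α :: s', α :: t') := by
      have hab : a ≠ b := by simpa using hα
      simp only [Rule.Guard, List.head?_cons, id, Option.some.injEq] at h
      rcases h with ⟨rfl, rfl⟩ | ⟨rfl, rfl⟩
      · exact ⟨_, _, Prod.ext (substTerm_cons_self y [b, .inr y] s)
          (substTerm_cons_of_ne hab.symm [b, .inr y] t)⟩
      · exact ⟨_, _, Prod.ext (substTerm_cons_of_ne hab [a, .inr y] s)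
          (substTerm_cons_self y [a, .inr y] t)⟩
    obtain ⟨s', t', h'⟩ := key
    rw [h']
    have := eqWeight_trimEq_le f (s', t')
    simp only [trimEq, if_true]
    simp only [eqWeight, List.map_cons, List.sum_cons] at this ⊢
    omega

theorem sum_count_eq_weight (x : V) (Φ : System A V) :
    (Φ.map fun e => (e.1 ++ e.2).count (Sum.inr x)).sum =
      weight (fun c => if c = Sum.inr x then 1 else 0) Φ := by
  have h : ∀ t : Term A V, t.count (Sum.inr x) =
      (t.map fun c => if c = Sum.inr x then 1 else 0).sum := by
    intro t
    induction t with
    | nil => rfl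
    | cons c t ih => rw [List.count_cons, ih, List.map_cons, List.sum_cons, add_comm]; simp
  simp only [h, List.map_append, List.sum_append]
  rfl

/-- Occurrences of a variable are a weight, so one monotonicity statement for all weights gives both
preservation of quadraticity and the bound on size. -/
theorem isQuadratic_iff_weight {Φ : System A V} :
    IsQuadratic Φ ↔ ∀ x, weight (fun c => if c = Sum.inr x then 1 else 0) Φ ≤ 2 :=
  forall_congr' fun x => by rw [sum_count_eq_weight]

theorem IsQuadratic.of_weight_le {Φ Φ' : System A V} (h : IsQuadratic Φ)
    (h' : ∀ f, weight f Φ' ≤ weight f Φ) : IsQuadratic Φ' :=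
  isQuadratic_iff_weight.2 fun x => (h' _).trans (isQuadratic_iff_weight.1 h x)

theorem weight_map_step_erase_le (f : A ⊕ V → ℕ) (y : V) (Φ : System A V) :
    weight f (Φ.map (Rule.erase y : Rule A V).step) +
      (Φ.map fun e => (e.1 ++ e.2).count (Sum.inr y)).sum * f (.inr y) ≤ weight f Φ := by
  induction Φ with
  | nil => simp [weight]
  | cons e Φ ih =>
    rw [List.map_cons, weight_cons, weight_cons, List.map_cons, List.sum_cons, add_mul]
    have h₁ := eqWeight_substEq_erase f y e
    have h₂ := eqWeight_trimEq_le f ((Rule.erase y : Rule A V).substEq e)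
    rw [← Rule.step] at h₂
    linarith

theorem weight_map_step_prepend_le (f : A ⊕ V → ℕ) (y : V) (α : A ⊕ V) (Φ : System A V) :
    weight f (Φ.map (Rule.prepend y α).step) ≤
      weight f Φ + (Φ.map fun e => (e.1 ++ e.2).count (Sum.inr y)).sum * f α := by
  induction Φ with
  | nil => simp [weight]
  | cons e Φ ih =>
    rw [List.map_cons, weight_cons, weight_cons, List.map_cons, List.sum_cons, add_mul]
    have h₁ := eqWeight_substEq_prepend f y α e
    have h₂ := eqWeight_trimEq_le f ((Rule.prepend y α).substEq e)
    rw [← Rule.step] at h₂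
    linarith

/-- Nielsen steps on quadratic systems do not increase weights. -/
theorem Rule.Applies.weight_le {ρ : Rule A V} {Φ Φ' : System A V} (h : ρ.Applies Φ Φ')
    (hΦ : IsTrimmed Φ) (hq : IsQuadratic Φ) (f : A ⊕ V → ℕ) : weight f Φ' ≤ weight f Φ := by
  refine Rule.applies_induction (M := fun Φ Φ' => IsTrimmed Φ → IsQuadratic Φ →
    weight f Φ' ≤ weight f Φ) ?_ ?_ h hΦ hq
  · intro e Φ hg hΦ hq
    cases ρ with
    | erase y =>
      exact (Nat.le_add_right _ _).trans (weight_map_step_erase_le f y (e :: Φ))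
    | prepend y α =>
      have h₁ := eqWeight_step_prepend_le f (hΦ e (by simp)) hg
      have h₂ := eqWeight_substEq_prepend f y α e
      have h₃ := weight_map_step_prepend_le f y α Φ
      -- Quadraticity: at most two copies of `α` are inserted in the whole system, which pays for
      -- the two removed in `h₁`.
      have h₄ := Nat.mul_le_mul_right (f α) (hq y)
      rw [List.map_cons, List.sum_cons, add_mul] at h₄
      rw [List.map_cons, weight_cons, weight_cons]
      linarith
  · intro Φ Φ' _ ih hΦ hq
    rw [weight_cons, weight_cons]
    refine Nat.add_le_add_left (ih (fun d hd => hΦ d (by simp [hd])) fun x => ?_) _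
    simpa using hq x

theorem Rule.Applies.weight_lt_of_erase {y : V} {Φ Φ' : System A V}
    (h : (Rule.erase y : Rule A V).Applies Φ Φ') :
    weight (fun _ => 1) Φ' < weight (fun _ => 1) Φ := by
  suffices ∀ ρ : Rule A V, ρ.Applies Φ Φ' → ρ = .erase y →
    weight (fun _ => 1) Φ' < weight (fun _ => 1) Φ from this _ h rfl
  intro ρ h
  refine Rule.applies_induction (M := fun Φ Φ' => ρ = .erase y →
    weight (fun _ => 1) Φ' < weight (fun _ => 1) Φ) ?_ ?_ h
  · rintro e Φ hg rfl
    have h₁ := weight_map_step_erase_le (fun _ => 1) y (e :: Φ)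
    have h₂ : 0 < (e.1 ++ e.2).count (Sum.inr y) :=
      List.count_pos_iff.2 (List.mem_append.2 hg.var_mem)
    rw [List.map_cons (l := Φ) (f := fun e => (e.1 ++ e.2).count (Sum.inr y)), List.sum_cons] at h₁
    omega
  · intro Φ Φ' _ ih hρ
    exact Nat.add_lt_add_left (ih hρ) _

/-! ### Progress towards a solution -/

theorem isTrimmed_map_trimEq (Φ : System A V) :
    IsTrimmed (Φ.map fun e => trimEq e.1 e.2) := by
  intro e he
  obtain ⟨d, -, rfl⟩ := List.mem_map.1 he
  exact trimEq_trimEq _ _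

theorem weight_map_trimEq_le (f : A ⊕ V → ℕ) (Φ : System A V) :
    weight f (Φ.map fun e => trimEq e.1 e.2) ≤ weight f Φ := by
  induction Φ with
  | nil => rfl
  | cons e Φ ih => exact add_le_add (eqWeight_trimEq_le f e) ih

/-- A rule that is compatible with the given model of an equation. -/
theorem exists_guard_of_eval_eq {I : Assignment A V} {e : Equation A V}
    (he : trimEq e.1 e.2 = e) (hne : e ≠ ([], [])) (hI : I.eval e.1 = I.eval e.2) :
    (∃ y, (Rule.erase y : Rule A V).Guard id e.1.head? e.2.head? ∧ I y = []) ∨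
      ∃ y α v, (Rule.prepend y α).Guard id e.1.head? e.2.head? ∧ α ≠ .inr y ∧
        I.eval [α] ≠ [] ∧ I y = I.eval [α] ++ v := by
  have hhead := head?_ne_of_trimmed he hne
  have eval_nil_of : ∀ {c : A ⊕ V}, I.eval [c] = [] → ∃ y, c = .inr y ∧ I y = [] := by
    rintro (a | y) h
    · simp at h
    · exact ⟨y, rfl, by simpa using h⟩
  obtain ⟨_ | ⟨a, s⟩, _ | ⟨b, t⟩⟩ := e
  · exact absurd rfl hne
  · rw [I.eval_cons] at hI
    obtain ⟨y, rfl, hy⟩ := eval_nil_of (List.append_eq_nil_iff.1 hI.symm).1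
    exact .inl ⟨y, .inr rfl, hy⟩
  · rw [I.eval_cons] at hI
    obtain ⟨y, rfl, hy⟩ := eval_nil_of (List.append_eq_nil_iff.1 hI).1
    exact .inl ⟨y, .inl rfl, hy⟩
  · have hab : a ≠ b := by simpa using hhead
    by_cases ha : I.eval [a] = []
    · obtain ⟨y, rfl, hy⟩ := eval_nil_of ha
      exact .inl ⟨y, .inl rfl, hy⟩
    by_cases hb : I.eval [b] = []
    · obtain ⟨y, rfl, hy⟩ := eval_nil_of hb
      exact .inl ⟨y, .inr rfl, hy⟩
    right
    simp only at hI
    rw [I.eval_cons a, I.eval_cons b] at hI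
    rcases a with a | x <;> rcases b with b | y
    · simp at hI
      exact absurd (congrArg _ hI.1) hab
    · cases hy : I y with
      | nil => simp [hy] at hb
      | cons c v =>
        obtain rfl : a = c := by simp [hy] at hI; exact hI.1
        exact ⟨y, .inl a, v, .inr ⟨rfl, rfl⟩, by simp, by simp, hy⟩
    · cases hx : I x with
      | nil => simp [hx] at ha
      | cons c v =>
        obtain rfl : c = b := by simp [hx] at hI; exact hI.1
        exact ⟨x, .inl c, v, .inl ⟨rfl, rfl⟩, by simp, by simp, hx⟩
    · have hxy : x ≠ y := fun h => hab (h ▸ rfl)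
      simp only [Assignment.eval_inr] at hI ha hb
      -- The values of the two leading variables are prefixes of the same word, so one is a prefix
      -- of the other; the variable with the longer value is replaced.
      rcases List.append_eq_append_iff.1 hI with ⟨v, hv, -⟩ | ⟨v, hv, -⟩
      · exact ⟨y, .inr x, v, .inr ⟨rfl, rfl⟩, by simpa using hxy, by simpa using ha,
          by simpa using hv⟩
      · exact ⟨x, .inr y, v, .inl ⟨rfl, rfl⟩, by simpa using hxy.symm, by simpa using hb,
          by simpa using hv⟩

/-- A trimmed system with a model that is not completely solved admits a Nielsen step to a system
with a smaller model. -/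
theorem exists_applies_of_isModel [Fintype V] {Φ : System A V} (hΦ : IsTrimmed Φ)
    (hne : ∃ e ∈ Φ, e ≠ ([], [])) {I : Assignment A V} (hI : IsModel I Φ) :
    ∃ (ρ : Rule A V) (Φ' : System A V) (J : Assignment A V), ρ.Applies Φ Φ' ∧ IsModel J Φ' ∧
      Prod.Lex (· < ·) (· < ·) (∑ x, (J x).length, weight (fun _ => 1) Φ')
        (∑ x, (I x).length, weight (fun _ => 1) Φ) := by
  have hsplit : ∃ Φ₁ e Φ₂, Φ = Φ₁ ++ e :: Φ₂ ∧ (∀ d ∈ Φ₁, d = ([], [])) ∧ e ≠ ([], []) := by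
    clear hΦ hI
    induction Φ with
    | nil => simp at hne
    | cons d Φ ih =>
      by_cases hd : d = ([], [])
      · subst hd
        obtain ⟨Φ₁, e, Φ₂, rfl, h₁, h₂⟩ := ih (by simpa [-Prod.exists] using hne)
        exact ⟨([], []) :: Φ₁, e, Φ₂, rfl, by simpa using h₁, h₂⟩
      · exact ⟨[], d, Φ, rfl, by simp, hd⟩
  obtain ⟨Φ₁, e, Φ₂, rfl, h₁, he⟩ := hsplit
  have happ : ∀ ρ : Rule A V, ρ.Guard id e.1.head? e.2.head? →
      ρ.Applies (Φ₁ ++ e :: Φ₂) (Φ₁ ++ (e :: Φ₂).map ρ.step) :=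
    fun ρ h => ⟨Φ₁, e, Φ₂, rfl, h₁, h, rfl⟩
  rcases exists_guard_of_eval_eq (hΦ e (by simp)) he (hI e (by simp)) with
    ⟨y, hg, hy⟩ | ⟨y, α, v, hg, hα, hα', hy⟩
  · exact ⟨_, _, I, happ _ hg, ((happ _ hg).isModel_iff (J := I) hy fun _ _ => rfl).2 hI,
      .right _ (happ _ hg).weight_lt_of_erase⟩
  -- The new model strips the value of `α` off the value of `y`. It agrees with `I` on `α` because
  -- `α` is not `y`, and is shorter because that value is non-empty.
  · have hJα : Assignment.eval (Function.update I y v) [α] = I.eval [α] := by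
      rcases α with a | x
      · rfl
      · have : x ≠ y := fun h => hα (h ▸ rfl)
        simp [this]
    refine ⟨_, _, Function.update I y v, happ _ hg,
      ((happ _ hg).isModel_iff (J := I) ?_ ?_).2 hI, .left _ _ ?_⟩
    · rw [Rule.replacement, Assignment.eval_cons, hJα]
      simpa [Rule.var] using hy
    · intro x hx
      exact (Function.update_of_ne hx _ _).symm
    · refine Finset.sum_lt_sum (fun x _ => ?_) ⟨y, Finset.mem_univ _, ?_⟩
      · by_cases hx : x = y
        · subst hx
          simp [hy]
        · simp [hx]
      · simp [hy, List.length_pos_iff, hα']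

end Nielsen

section Algorithm

variable {A : Type*} {V : Type*}

/-! ### The sets explored by the algorithm -/

/-- The words processed in the first `i` iterations of the main loop. -/
def processed (P : RMCProblem A V) : ℕ → Language (Letter A V)
  | 0 => 0
  | i + 1 => processed P i + P.reach i

theorem mem_processed {P : RMCProblem A V} {i : ℕ} {w : List (Letter A V)} :
    w ∈ processed P i ↔ ∃ j < i, w ∈ P.reach j := by
  induction i with
  | zero => simp [processed, Language.notMem_zero]
  | succ i ih =>
    rw [processed, Language.mem_add, ih]
    constructor
    · rintro (⟨j, hj, h⟩ | h)
      · exact ⟨j, by omega, h⟩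
      · exact ⟨i, by omega, h⟩
    · rintro ⟨j, hj, h⟩
      rcases Nat.lt_succ_iff_lt_or_eq.1 hj with hj | rfl
      · exact .inl ⟨j, hj, h⟩
      · exact .inr h

theorem decodeSystem_of_mem_dest {w : List (Letter A V)}
    (hw : ∀ c ∈ w, c = padLetter ∨ c = Letter.delim) : ∀ e ∈ decodeSystem w, e = ([], []) := by
  have key : (∀ c ∈ (splitBlocks w).1, c = (none, none)) ∧
      ∀ y ∈ (splitBlocks w).2, ∀ c ∈ y, c = (none, none) := by
    induction w with
    | nil => simp [splitBlocks]
    | cons c w ih =>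
      obtain ⟨h₁, h₂⟩ := ih fun c hc => hw c (by simp [hc])
      rcases hw c (by simp) with rfl | rfl
      · exact ⟨by simpa [splitBlocks, -Prod.forall] using h₁, h₂⟩
      · exact ⟨by simp [splitBlocks], by simpa [splitBlocks, -Prod.forall] using ⟨h₁, h₂⟩⟩
  have hdec : ∀ x : List (Cell A V), (∀ c ∈ x, c = (none, none)) → decode x = ([], []) := by
    intro x hx
    rw [List.eq_replicate_of_mem hx]
    simpa [eqEncode] using decode_eqEncode ([] : Term A V) [] x.length
  intro e he
  rcases List.mem_cons.1 he with rfl | he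
  · exact hdec _ key.1
  · obtain ⟨y, hy, rfl⟩ := List.mem_map.1 he
    exact hdec y (key.2 y hy)

variable [DecidableEq A] [DecidableEq V]

/-- The systems obtained from `Φ`, after trimming, by `i` Nielsen steps. -/
def nielsen (Φ : System A V) : ℕ → Set (System A V)
  | 0 => {Φ.map fun e => trimEq e.1 e.2}
  | i + 1 => {Φ' | ∃ Ψ ∈ nielsen Φ i, ∃ ρ : Rule A V, ρ.Applies Ψ Φ'}

theorem isTrimmed_of_mem_nielsen {Φ Ψ : System A V} {i : ℕ} (h : Ψ ∈ nielsen Φ i) :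
    IsTrimmed Ψ := by
  cases i with
  | zero =>
    obtain rfl : Ψ = Φ.map _ := h
    exact isTrimmed_map_trimEq Φ
  | succ i =>
    obtain ⟨_, -, ρ, h⟩ := h
    exact h.isTrimmed

theorem weight_le_of_mem_nielsen {Φ Ψ : System A V} (hΦ : IsQuadratic Φ) {i : ℕ}
    (h : Ψ ∈ nielsen Φ i) : Ψ.length = Φ.length ∧ ∀ f, weight f Ψ ≤ weight f Φ := by
  induction i generalizing Ψ with
  | zero =>
    obtain rfl : Ψ = Φ.map _ := h
    exact ⟨List.length_map _, fun f => weight_map_trimEq_le f Φ⟩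
  | succ i ih =>
    obtain ⟨Ψ', hΨ', ρ, h⟩ := h
    obtain ⟨h₁, h₂⟩ := ih hΨ'
    exact ⟨h.length_eq.trans h₁, fun f =>
      (h.weight_le (isTrimmed_of_mem_nielsen hΨ') (hΦ.of_weight_le h₂) f).trans (h₂ f)⟩

theorem encodeSystem_map_trimEq (Φ : System A V) :
    encodeSystem (Φ.map fun e => trimEq e.1 e.2) = encodeSystem Φ := by
  ext w
  refine exists_congr fun ws => and_congr_left fun _ => ?_
  rw [List.forall₂_map_left_iff]
  simp only [encode_trimEq]

/-- Each new word comes from a single word by a single rule, so `post` distributes over unions. -/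
theorem mem_post {Φ : System A V} {L : Language (Letter A V)} {z : List (Letter A V)} :
    z ∈ (quadraticProblem Φ).post L ↔ ∃ w ∈ L, ∃ (ρ : Rule A V) (w' : List (Letter A V)),
      (w, w') ∈ ruleSeqRel ρ 2 ∧ (w', z) ∈ padDelRel := by
  refine mem_saturBullet.trans ?_
  constructor
  · rintro ⟨w', ⟨w, hw, h⟩, hz⟩
    rcases h with h | h
    · obtain ⟨y, h⟩ := mem_iUnion.1 h
      obtain ⟨α, h⟩ := mem_iUnion.1 h
      exact ⟨w, hw, _, w', h, hz⟩
    · obtain ⟨y, h⟩ := mem_iUnion.1 h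
      exact ⟨w, hw, _, w', h, hz⟩
  · rintro ⟨w, hw, ρ, w', h, hz⟩
    refine ⟨w', ⟨w, hw, ?_⟩, hz⟩
    cases ρ with
    | prepend y α => exact .inl (mem_iUnion.2 ⟨y, mem_iUnion.2 ⟨α, h⟩⟩)
    | erase y => exact .inr (mem_iUnion.2 ⟨y, h⟩)

theorem exists_applies_of_mem_post {Φ Ψ : System A V} (hΨ : IsTrimmed Ψ)
    {w z : List (Letter A V)} (hw : w ∈ encodeSystem Ψ)
    (hz : z ∈ (quadraticProblem Φ).post {w}) :
    ∃ (ρ : Rule A V) (Ψ' : System A V), ρ.Applies Ψ Ψ' ∧ z ∈ encodeSystem Ψ' := by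
  obtain ⟨_, rfl, ρ, w', h, hz⟩ := mem_post.1 hz
  obtain ⟨Ψ', hΨ', hw'⟩ := exists_applies_of_mem_ruleSeqRel hΨ hw h
  exact ⟨ρ, Ψ', hΨ', mem_encodeSystem_of_padDelRel hw' hz⟩

/-- The words of `reach_i` are the encodings of the systems obtained by `i` Nielsen steps. -/
theorem mem_reach {Φ : System A V} (hΦ : IsQuadratic Φ) {i : ℕ} {w : List (Letter A V)} :
    w ∈ (quadraticProblem Φ).reach i ↔ ∃ Ψ ∈ nielsen Φ i, w ∈ encodeSystem Ψ := by
  induction i generalizing w with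
  | zero =>
    change w ∈ encodeSystem Φ ↔ _
    simp [nielsen, encodeSystem_map_trimEq]
  | succ i ih =>
    constructor
    · intro h
      obtain ⟨w', hw', h⟩ := mem_post.1 h
      obtain ⟨Ψ, hΨ, hw'Ψ⟩ := ih.1 hw'
      obtain ⟨ρ, Ψ', hap, hw⟩ := exists_applies_of_mem_post (Φ := Φ)
        (isTrimmed_of_mem_nielsen hΨ) hw'Ψ (mem_post.2 ⟨w', rfl, h⟩)
      exact ⟨Ψ', ⟨Ψ, hΨ, ρ, hap⟩, hw⟩
    · rintro ⟨Ψ', ⟨Ψ, hΨ, ρ, hap⟩, hw⟩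
      have hq : IsQuadratic Ψ := hΦ.of_weight_le (weight_le_of_mem_nielsen hΦ hΨ).2
      obtain ⟨w', hw', w'', h⟩ := exists_mem_ruleSeqRel_of_applies (n := 2)
        (isTrimmed_of_mem_nielsen hΨ)
        -- The occurrences in one equation are bounded by those in the whole system, so the bound
        -- `2` of the transducers suffices.
        (fun e he => (List.le_sum_of_mem
          (List.mem_map_of_mem (f := fun e => (e.1 ++ e.2).count (Sum.inr ρ.var)) he)).trans
            (hq ρ.var)) hap hw
      exact mem_post.2 ⟨w', ih.2 ⟨Ψ, hΨ, hw'⟩, ρ, w'', h⟩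

/-- Otherwise every level contains a system that is absent from all earlier levels. These are
infinitely many distinct systems of bounded size, a contradiction. -/
theorem exists_reach_le_processed [Finite A] [Finite V] {Φ : System A V} (hΦ : IsQuadratic Φ) :
    ∃ N, (quadraticProblem Φ).reach N ≤ processed (quadraticProblem Φ) N := by
  by_contra! h
  have h' : ∀ N, ∃ Ψ ∈ nielsen Φ N, ∀ j < N, Ψ ∉ nielsen Φ j := by
    intro N
    by_contra! hN
    refine h N fun w hw => ?_
    obtain ⟨Ψ, hΨ, hw⟩ := (mem_reach hΦ).1 hw
    obtain ⟨j, hj, hΨj⟩ := hN Ψ hΨ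
    exact mem_processed.2 ⟨j, hj, (mem_reach hΦ).2 ⟨Ψ, hΨj, hw⟩⟩
  choose Ψ hΨ hΨ' using h'
  have hinj : Function.Injective Ψ := by
    intro i j hij
    by_contra hne
    rcases lt_or_gt_of_ne hne with hlt | hlt
    · exact hΨ' j i hlt (hij ▸ hΨ i)
    · exact hΨ' i j hlt (hij ▸ hΨ j)
  refine Set.infinite_of_injective_forall_mem hinj (fun i => ?_)
    (finite_setOf_weight_le Φ.length (weight (fun _ => 1) Φ))
  obtain ⟨h₁, h₂⟩ := weight_le_of_mem_nielsen hΦ (hΨ i)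
  exact ⟨h₁, h₂ _⟩

/-- Once the loop ends, nothing new is ever reached. -/
theorem mem_processed_of_reach_le {Φ : System A V} {i : ℕ}
    (h : (quadraticProblem Φ).reach i ≤ processed (quadraticProblem Φ) i) (k : ℕ)
    {w : List (Letter A V)} (hw : w ∈ (quadraticProblem Φ).reach k) :
    w ∈ processed (quadraticProblem Φ) i := by
  by_cases hki : k < i
  · exact mem_processed.2 ⟨k, hki, hw⟩
  obtain ⟨d, rfl⟩ := Nat.exists_eq_add_of_le (not_lt.1 hki)
  clear hki
  induction d generalizing w with
  | zero => exact h hw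
  | succ d ih =>
    obtain ⟨w', hw', hpost⟩ := mem_post.1 hw
    obtain ⟨j, hj, hw'⟩ := mem_processed.1 (ih hw')
    have hwj : w ∈ (quadraticProblem Φ).reach (j + 1) := mem_post.2 ⟨w', hw', hpost⟩
    rcases Nat.lt_or_eq_of_le (Nat.succ_le_of_lt hj) with hlt | heq
    · exact mem_processed.2 ⟨j + 1, hlt, hwj⟩
    · rw [Nat.succ_eq_add_one] at heq
      subst heq
      exact h hwj

theorem exists_mem_dest_of_solved {Φ : System A V} (hΦ : ∀ e ∈ Φ, e = ([], [])) :
    ∃ w ∈ encodeSystem Φ, ∀ c ∈ w, c = padLetter ∨ c = Letter.delim := by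
  induction Φ with
  | nil => exact ⟨[], mem_encodeSystem_nil.2 rfl, by simp⟩
  | cons e Φ ih =>
    obtain ⟨w, hw, h⟩ := ih fun e he => hΦ e (by simp [he])
    obtain rfl := hΦ e (by simp)
    cases Φ with
    | nil => exact ⟨[], mem_encodeSystem_singleton.2 ⟨[], mem_encode_nil.2 rfl, rfl⟩, by simp⟩
    | cons e' Φ =>
      exact ⟨_, (mem_encodeSystem_nil_cons (by simp)).2 ⟨w, hw, rfl⟩, by simpa using h⟩

theorem exists_solved_mem_nielsen [Finite V] {Φ : System A V} {I : Assignment A V}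
    (hI : IsModel I Φ) : ∃ i, ∃ Ψ ∈ nielsen Φ i, ∀ e ∈ Ψ, e = ([], []) := by
  have := Fintype.ofFinite V
  -- Well-founded induction on (total length of the model, size of the system): `y ↪ αy` shortens
  -- the model, and `y ↪ ε` keeps it and shrinks the system.
  suffices ∀ (m : ℕ × ℕ) (i : ℕ) (Ψ : System A V) (I : Assignment A V), Ψ ∈ nielsen Φ i →
      IsModel I Ψ → m = (∑ x, (I x).length, weight (fun _ => 1) Ψ) →
      ∃ i, ∃ Ψ ∈ nielsen Φ i, ∀ e ∈ Ψ, e = ([], []) from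
    this _ 0 _ I rfl ((isModel_map_trimEq I Φ).2 hI) rfl
  intro m
  induction m using (WellFounded.prod_lex (α := ℕ) (β := ℕ) wellFounded_lt wellFounded_lt).induction
    with | _ m ih
  rintro i Ψ I hΨ hI rfl
  by_cases hsol : ∀ e ∈ Ψ, e = ([], [])
  · exact ⟨i, Ψ, hΨ, hsol⟩
  · push Not at hsol
    obtain ⟨ρ, Ψ', J, hap, hJ, hlt⟩ :=
      exists_applies_of_isModel (isTrimmed_of_mem_nielsen hΨ) hsol hI
    exact ih _ hlt (i + 1) Ψ' J ⟨Ψ, hΨ, ρ, hap⟩ hJ rfl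

theorem exists_mem_dest_reach [Finite V] {Φ : System A V} (hΦ : IsQuadratic Φ)
    (hI : ∃ I, IsModel I Φ) :
    ∃ i, ∃ w ∈ (quadraticProblem Φ).dest, w ∈ (quadraticProblem Φ).reach i := by
  obtain ⟨I, hI⟩ := hI
  obtain ⟨i, Ψ, hΨ, hsol⟩ := exists_solved_mem_nielsen hI
  obtain ⟨w, hw, hdest⟩ := exists_mem_dest_of_solved hsol
  exact ⟨i, w, hdest, (mem_reach hΦ).2 ⟨Ψ, hΨ, hw⟩⟩

/-! ### Runs of the algorithm -/

/-- The invariant of the model extraction. -/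
def Extracted (w : List (Letter A V)) (I : Assignment A V) : Prop :=
  IsModel I (decodeSystem w) ∧ ∀ x, ¬ Occurs x (decodeSystem w) → I x = []

theorem decodeSystem_eq_of_trimmed {Φ : System A V} (hΦ : IsTrimmed Φ) (hne : Φ ≠ [])
    {w : List (Letter A V)} (hw : w ∈ encodeSystem Φ) : decodeSystem w = Φ := by
  rw [decodeSystem_of_mem hne hw]
  exact (List.map_congr_left hΦ).trans (List.map_id Φ)

/-- A rule chosen in the extraction comes with its own pair of systems. Both are trimmed and
non-empty, hence equal to the decodings of the two words, so every choice preserves the invariant.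
-/
theorem Extracted.undo {w w' : List (Letter A V)} {I : Assignment A V} {ρ : Rule A V}
    (h : Extracted w I) (hw : w ∈ ruleImage w' ρ) : Extracted w' (ρ.undo I) := by
  obtain ⟨Φ, Φ', hΦ, hw', hap, hw⟩ := hw
  rw [Extracted, decodeSystem_eq_of_trimmed hap.isTrimmed hap.ne_nil.2 hw] at h
  rw [Extracted, decodeSystem_eq_of_trimmed hΦ hap.ne_nil.1 hw']
  exact hap.undo h.1 h.2

theorem Extracted.isModel {Φ : System A V} {w : List (Letter A V)} {I : Assignment A V}
    (h : Extracted w I) (hw : w ∈ encodeSystem Φ) : IsModel I Φ := by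
  by_cases hne : Φ = []
  · subst hne
    exact fun e he => absurd he (by simp)
  · have := h.1
    rwa [decodeSystem_of_mem hne hw, isModel_map_trimEq] at this

/-- The invariant of the runs, where the loop is known to end after at most `N` iterations. -/
def RunInvariant (Φ : System A V) (N : ℕ) : RMCProblem.Config A V → Prop
  | .main i p => i ≤ N ∧ p = processed (quadraticProblem Φ) i ∧
      ∀ j < i, ∀ w ∈ (quadraticProblem Φ).dest, w ∉ (quadraticProblem Φ).reach j
  | .extract ℓ w I => ℓ ≤ N ∧ w ∈ (quadraticProblem Φ).reach ℓ ∧ Extracted w I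
  | .ret (some I) => IsModel I Φ
  | .ret none => ∃ i, (quadraticProblem Φ).reach i ≤ processed (quadraticProblem Φ) i ∧
      ∀ j < i, ∀ w ∈ (quadraticProblem Φ).dest, w ∉ (quadraticProblem Φ).reach j

/-- An upper bound on the number of remaining steps of a run. -/
def remaining (N : ℕ) : RMCProblem.Config A V → ℕ
  | .main i _ => 2 * N + 2 - i
  | .extract ℓ _ _ => ℓ + 1
  | .ret _ => 0

/-- The loop cannot pass `N`, where nothing new is found. An extraction from level `i ≤ N` takes `i
+ 1` steps, fewer than `2 * N + 2 - i`, so entering it decreases `remaining`. -/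
theorem RunInvariant.step {Φ : System A V} {N : ℕ}
    (hN : (quadraticProblem Φ).reach N ≤ processed (quadraticProblem Φ) N)
    {c c' : RMCProblem.Config A V} (h : RunInvariant Φ N c) (hs : (quadraticProblem Φ).Step c c') :
    RunInvariant Φ N c' ∧ remaining N c' < remaining N c := by
  cases hs with
  | @unsat i _ hle =>
    obtain ⟨hi, rfl, hdest⟩ := h
    exact ⟨⟨i, hle, hdest⟩, by simp only [remaining]; omega⟩
  | @found i _ w hle hw hwi =>
    obtain ⟨hi, rfl, hdest⟩ := h
    have hsol := decodeSystem_of_mem_dest hw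
    -- A word of the destination set decodes to empty equations only, so the initial assignment of
    -- empty words is a model.
    refine ⟨⟨hi, hwi, fun e he => ?_, fun _ _ => rfl⟩, by simp only [remaining]; omega⟩
    rw [hsol e he]
  | @iterate i _ hle hd =>
    obtain ⟨hi, rfl, hdest⟩ := h
    have hiN : i ≠ N := by
      rintro rfl
      exact hle hN
    refine ⟨⟨by omega, rfl, fun j hj => ?_⟩, by simp only [remaining]; omega⟩
    rcases Nat.lt_succ_iff_lt_or_eq.1 hj with hj | rfl
    · exact hdest j hj
    · exact hd
  | @back ℓ w w' I ρ hw' hpost hw =>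
    obtain ⟨hℓ, -, hex⟩ := h
    exact ⟨⟨by omega, hw', hex.undo hw⟩, by simp only [remaining]; omega⟩
  | @done w I =>
    obtain ⟨-, hw, hex⟩ := h
    exact ⟨hex.isModel hw, by simp [remaining]⟩

theorem RunInvariant.main_zero (Φ : System A V) (N : ℕ) : RunInvariant Φ N (.main 0 0) :=
  ⟨Nat.zero_le _, rfl, by simp⟩

theorem RunInvariant.of_reaches {Φ : System A V} {N : ℕ}
    (hN : (quadraticProblem Φ).reach N ≤ processed (quadraticProblem Φ) N)
    {c : RMCProblem.Config A V} (h : (quadraticProblem Φ).Reaches c) : RunInvariant Φ N c := by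
  induction h with
  | refl => exact .main_zero Φ N
  | tail _ hs ih => exact (ih.step hN hs).1

/-- The extraction does not block: the current word has a predecessor under `post`, and by the
simulation this transition is an actual Nielsen step, which supplies the rule. -/
theorem exists_ret_of_stuck {Φ : System A V} (hΦ : IsQuadratic Φ) {N : ℕ}
    {c : RMCProblem.Config A V} (h : RunInvariant Φ N c)
    (hc : ¬ ∃ c', (quadraticProblem Φ).Step c c') : ∃ r, c = .ret r := by
  cases c with
  | main i p =>
    refine absurd ?_ hc
    by_cases hle : (quadraticProblem Φ).reach i ≤ p
    · exact ⟨_, .unsat hle⟩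
    · by_cases hd : ∃ w ∈ (quadraticProblem Φ).dest, w ∈ (quadraticProblem Φ).reach i
      · obtain ⟨w, hw, hwi⟩ := hd
        exact ⟨_, .found hle hw hwi⟩
      · push Not at hd
        exact ⟨_, .iterate hle hd⟩
  | extract ℓ w I =>
    refine absurd ?_ hc
    cases ℓ with
    | zero => exact ⟨_, .done⟩
    | succ ℓ =>
      obtain ⟨-, hw, -⟩ := h
      obtain ⟨w', hw', hpost⟩ := mem_post.1 hw
      have hpost : w ∈ (quadraticProblem Φ).post {w'} := mem_post.2 ⟨w', rfl, hpost⟩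
      obtain ⟨Ψ, hΨ, hw'Ψ⟩ := (mem_reach hΦ).1 hw'
      have htrim := isTrimmed_of_mem_nielsen hΨ
      obtain ⟨ρ, Ψ', hap, hwΨ'⟩ := exists_applies_of_mem_post htrim hw'Ψ hpost
      exact ⟨_, .back (ρ := ρ) hw' hpost ⟨Ψ, Ψ', htrim, hw'Ψ, hap, hwΨ'⟩⟩
  | ret r => exact ⟨r, rfl⟩

theorem alwaysReturns_quadraticProblem [Finite A] [Finite V] {Φ : System A V}
    (hΦ : IsQuadratic Φ) {Q : Option (Assignment A V) → Prop}
    (hQ : ∀ N r, RunInvariant Φ N (.ret r) → Q r) : (quadraticProblem Φ).AlwaysReturns Q := by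
  obtain ⟨N, hN⟩ := exists_reach_le_processed hΦ
  constructor
  · rintro ⟨c, hc₀, hc⟩
    have key : ∀ n, RunInvariant Φ N (c n) ∧ remaining N (c n) + n ≤ remaining N (c 0) := by
      intro n
      induction n with
      | zero => exact ⟨hc₀ ▸ .main_zero Φ N, le_rfl⟩
      | succ n ih =>
        obtain ⟨h₁, h₂⟩ := ih.1.step hN (hc n)
        exact ⟨h₁, by omega⟩
    have := (key (remaining N (c 0) + 1)).2
    omega
  · intro c hc hstuck
    have hinv := RunInvariant.of_reaches hN hc
    obtain ⟨r, rfl⟩ := exists_ret_of_stuck hΦ hinv hstuck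
    exact ⟨r, rfl, hQ N r hinv⟩

theorem isSound_quadraticProblem [Finite A] [Finite V] {Φ : System A V} (hΦ : IsQuadratic Φ) :
    (quadraticProblem Φ).IsSound Φ := by
  obtain ⟨N, hN⟩ := exists_reach_le_processed hΦ
  exact fun I hI => RunInvariant.of_reaches hN hI

theorem isComplete_quadraticProblem [Finite A] [Finite V] {Φ : System A V} (hΦ : IsQuadratic Φ) :
    (quadraticProblem Φ).IsComplete Φ := by
  intro hI
  refine alwaysReturns_quadraticProblem hΦ fun N r hr => ?_
  cases r with
  | some I => exact ⟨I, rfl, hr⟩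
  | none =>
    obtain ⟨i, hle, hdest⟩ := hr
    obtain ⟨k, w, hw, hwk⟩ := exists_mem_dest_reach hΦ hI
    -- The destination word was processed at some level `j` before the loop ended, but the loop
    -- continues past `j` only if that level contains no destination word.
    obtain ⟨j, hj, hwj⟩ := mem_processed.1 (mem_processed_of_reach_le hle k hwk)
    exact absurd hwj (hdest j hj w hw)

end Algorithm

end WordEq

theorem mainTheorem1 {A : Type*} {V : Type*} [Finite A] [Finite V]
    [DecidableEq A] [DecidableEq V]
    (Φ : WordEq.System A V) (hΦ : WordEq.IsQuadratic Φ) :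
    (WordEq.quadraticProblem Φ).IsEffective ∧
    (∀ i : ℕ, ((WordEq.quadraticProblem Φ).reach i).IsRegular) ∧
    (WordEq.quadraticProblem Φ).IsSound Φ ∧
    (WordEq.quadraticProblem Φ).IsComplete Φ ∧
    (WordEq.quadraticProblem Φ).IsTerminating :=
  ⟨WordEq.isEffective_quadraticProblem Φ, WordEq.isRegular_reach Φ,
    WordEq.isSound_quadraticProblem hΦ, WordEq.isComplete_quadraticProblem hΦ,
    WordEq.alwaysReturns_quadraticProblem hΦ fun _ _ _ => trivial⟩
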